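/- Let $S^2\subset\mathbb{R}^3$ be the unit sphere, let $g\colon S^2\to S^2$, $g(x)=-x$, be the antipodal involution, and let $\mathbb{RP}^2=S^2/g$ be the projective plane with quotient map $\pi\colon S^2\to\mathbb{RP}^2$. By a graph embedded in a space $X$ we mean a finite graph, possibly with multiple edges or loops, whose vertices are points of $X$ and whose edges are simple arcs in $X$ joining their ends (simple closed curves in the case of loops), such that no edge contains a vertex other than its ends and two different edges meet at most in vertices. A perfect matching of a graph is a set of non-loop edges such that every vertex is an end of exactly one of them. Theorem. Let $n\ge 0$ be an integer and let $Z$ be a bipartite graph, with vertices coloured black and white so that every edge joins a black vertex and a white vertex, embedded in $S^2$ and having $4n$ vertices. Suppose that $Z$ is invariant under $g$ (that is, $g$ maps vertices to vertices and edges to edges) and that $g$ exchanges the colours of the vertices: $g(v)$ is white for every black vertex $v$ and black for every white vertex $v$. Let $Z/g$ be the quotient graph, embedded in $\mathbb{RP}^2$, whose vertices and edges are the images under $\pi$ of the vertices and edges of $Z$. Then the number of perfect matchings of $Z$ is the square of the number of perfect matchings of $Z/g$. -/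

import Mathlib

/-- A finite (multi)graph embedded in a topological space `X`: the vertices are finitely many points
of `X`, the edges are finitely many subsets of `X`, each edge is a simple arc joining its two ends
(a simple closed curve based at its end, if the ends agree) that contains no vertex other than its
ends, and two different edges meet at most in vertices. Multiple edges and loops are allowed. -/
structure EmbeddedGraph (X : Type*) [TopologicalSpace X] extends Graph X (Set X) where
  finite_vertexSet : vertexSet.Finite
  finite_edgeSet : edgeSet.Finite
  exists_path : ∀ ⦃e x y⦄, IsLink e x y → ∃ γ : Path x y,
    (∀ s t, γ s = γ t → s = t ∨ (s = 0 ∧ t = 1) ∨ (s = 1 ∧ t = 0)) ∧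
      Set.range γ = e ∧ e ∩ vertexSet = {x, y}
  inter_subset : ∀ ⦃e f⦄, e ∈ edgeSet → f ∈ edgeSet → e ≠ f → e ∩ f ⊆ vertexSet

/-- A perfect matching of a multigraph: a set of edges, none of them a loop, such that every vertex
is an end of exactly one of them. -/
def Graph.IsPerfectMatching {α β : Type*} (G : Graph α β) (m : Set β) : Prop :=
  m ⊆ G.edgeSet ∧ (∀ e ∈ m, ∀ v, ¬ G.IsLoopAt e v) ∧
    ∀ v ∈ G.vertexSet, ∃! e, e ∈ m ∧ G.Inc e v

/-- The number of perfect matchings of a multigraph (meaningful when it has finitely many edges). -/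
noncomputable def Graph.numPerfectMatchings {α β : Type*} (G : Graph α β) : ℕ :=
  {m : Set β | G.IsPerfectMatching m}.ncard

/-- The unit sphere in `ℝ³`, on which `x ↦ -x` is the antipodal involution. -/
abbrev Sphere2 : Type := Metric.sphere (0 : EuclideanSpace ℝ (Fin 3)) 1

/-- Two points of the sphere are identified when they are equal or antipodal. -/
def antipodalSetoid : Setoid Sphere2 where
  r x y := x = y ∨ x = -y
  iseqv :=
    { refl := fun _ => Or.inl rfl
      symm := by
        rintro x y (rfl | rfl)
        · exact Or.inl rfl
        · exact Or.inr (neg_neg y).symm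
      trans := by
        rintro x y z (rfl | rfl) (rfl | rfl)
        · exact Or.inl rfl
        · exact Or.inr rfl
        · exact Or.inr rfl
        · exact Or.inl (neg_neg z) }

/-- The real projective plane, with the quotient topology. -/
abbrev ProjPlane : Type := Quotient antipodalSetoid

/-- The quotient map from the sphere to the projective plane. -/
def toProjPlane (x : Sphere2) : ProjPlane := Quotient.mk antipodalSetoid x

theorem continuous_toProjPlane : Continuous toProjPlane := continuous_quotient_mk'

theorem toProjPlane_eq_iff {x y : Sphere2} :
    toProjPlane x = toProjPlane y ↔ x = y ∨ x = -y :=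
  Quotient.eq (r := antipodalSetoid)

theorem toProjPlane_neg (x : Sphere2) : toProjPlane (-x) = toProjPlane x :=
  toProjPlane_eq_iff.2 (Or.inr rfl)

theorem Sphere2.ne_neg (x : Sphere2) : x ≠ -x := by
  intro h
  have h1 : (x : EuclideanSpace ℝ (Fin 3)) = -x := congrArg Subtype.val h
  have h2 : (x : EuclideanSpace ℝ (Fin 3)) = 0 := by
    ext i
    have h4 := congrArg (fun v : EuclideanSpace ℝ (Fin 3) => v i) h1
    simp only [PiLp.neg_apply] at h4
    simp only [PiLp.zero_apply]
    linarith
  have h3 : ‖(x : EuclideanSpace ℝ (Fin 3))‖ = 1 := by simp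
  rw [h2] at h3
  simp at h3

namespace EmbeddedGraph

/-- The embedded graph is mapped to itself by the antipodal involution: the antipode of every vertex
is a vertex, and the antipodal image of every edge is an edge. -/
def AntipodeInvariant (Z : EmbeddedGraph Sphere2) : Prop :=
  (∀ v ∈ Z.vertexSet, -v ∈ Z.vertexSet) ∧
    ∀ e ∈ Z.edgeSet, (fun x : Sphere2 => -x) '' e ∈ Z.edgeSet

theorem image_neg_neg (e : Set Sphere2) :
    (fun x : Sphere2 => -x) '' ((fun x : Sphere2 => -x) '' e) = e := by
  simp

theorem eq_zero_or_one {X : Type*} [TopologicalSpace X] (Z : EmbeddedGraph X) {x y : X}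
    {e : Set X} (γ : Path x y)
    (hγ : ∀ s t, γ s = γ t → s = t ∨ (s = 0 ∧ t = 1) ∨ (s = 1 ∧ t = 0))
    (hr : Set.range γ = e) (hV : e ∩ Z.vertexSet = {x, y}) {t : unitInterval}
    (ht : γ t ∈ Z.vertexSet) : t = 0 ∨ t = 1 := by
  have h : γ t ∈ ({x, y} : Set X) := hV ▸ ⟨hr ▸ ⟨t, rfl⟩, ht⟩
  rcases h with h | h
  · have := hγ t 0 (by rw [h, γ.source])
    tauto
  · have := hγ t 1 (by rw [h, γ.target])
    tauto

/-- Every edge has a point which is not a vertex. -/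
theorem exists_mem_notMem {X : Type*} [TopologicalSpace X] (Z : EmbeddedGraph X) {e : Set X}
    (he : e ∈ Z.edgeSet) : ∃ p ∈ e, p ∉ Z.vertexSet := by
  obtain ⟨x, y, hxy⟩ := (Z.edge_mem_iff_exists_isLink e).1 he
  obtain ⟨γ, hγ, hr, hV⟩ := Z.exists_path hxy
  let c : unitInterval := ⟨1 / 2, by norm_num, by norm_num⟩
  refine ⟨γ c, by rw [← hr]; exact ⟨c, rfl⟩, fun h => ?_⟩
  rcases Z.eq_zero_or_one γ hγ hr hV h with h | h <;>
  · have := congrArg Subtype.val h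
    norm_num [c] at this

theorem eq_of_mem_inter {X : Type*} [TopologicalSpace X] (Z : EmbeddedGraph X) {e f : Set X}
    (he : e ∈ Z.edgeSet) (hf : f ∈ Z.edgeSet) {p : X} (hpe : p ∈ e) (hpf : p ∈ f)
    (hp : p ∉ Z.vertexSet) : e = f := by
  by_contra h
  exact hp (Z.inter_subset he hf h ⟨hpe, hpf⟩)

theorem AntipodeInvariant.mem_of_neg {Z : EmbeddedGraph Sphere2} (h : Z.AntipodeInvariant)
    {v : Sphere2} (hv : -v ∈ Z.vertexSet) : v ∈ Z.vertexSet := by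
  simpa using h.1 _ hv

theorem AntipodeInvariant.isLink_neg {Z : EmbeddedGraph Sphere2} (h : Z.AntipodeInvariant)
    {e : Set Sphere2} {x y : Sphere2} (hl : Z.IsLink e x y) :
    Z.IsLink ((fun x : Sphere2 => -x) '' e) (-x) (-y) := by
  obtain ⟨a, b, hab⟩ := (Z.edge_mem_iff_exists_isLink _).1 (h.2 e hl.edge_mem)
  obtain ⟨-, -, -, hV⟩ := Z.exists_path hl
  obtain ⟨-, -, -, hV'⟩ := Z.exists_path hab
  have key : ({a, b} : Set Sphere2) = {-x, -y} := by
    rw [← hV']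
    ext p
    constructor
    · rintro ⟨⟨q, hq, rfl⟩, hp⟩
      have : q ∈ ({x, y} : Set Sphere2) := hV ▸ ⟨hq, h.mem_of_neg hp⟩
      rcases this with rfl | rfl
      · exact Or.inl rfl
      · exact Or.inr rfl
    · rintro (rfl | rfl)
      · have : x ∈ e ∩ Z.vertexSet := hV ▸ Or.inl rfl
        exact ⟨⟨x, this.1, rfl⟩, h.1 _ this.2⟩
      · have : y ∈ e ∩ Z.vertexSet := hV ▸ Or.inr rfl
        exact ⟨⟨y, this.1, rfl⟩, h.1 _ this.2⟩
  rw [Set.pair_eq_pair_iff] at key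
  rcases key with ⟨rfl, rfl⟩ | ⟨rfl, rfl⟩
  · exact hab
  · exact hab.symm

theorem AntipodeInvariant.eq_or_eq {Z : EmbeddedGraph Sphere2} (h : Z.AntipodeInvariant)
    {e f : Set Sphere2} (he : e ∈ Z.edgeSet) (hf : f ∈ Z.edgeSet)
    (hef : toProjPlane '' e = toProjPlane '' f) : e = f ∨ e = (fun x : Sphere2 => -x) '' f := by
  obtain ⟨p, hpe, hp⟩ := Z.exists_mem_notMem he
  have : toProjPlane p ∈ toProjPlane '' f := hef ▸ ⟨p, hpe, rfl⟩
  obtain ⟨q, hq, hqp⟩ := this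
  rcases toProjPlane_eq_iff.1 hqp.symm with rfl | rfl
  · exact Or.inl (Z.eq_of_mem_inter he hf hpe hq hp)
  · exact Or.inr (Z.eq_of_mem_inter he (h.2 f hf) hpe ⟨q, hq, rfl⟩ hp)

/-- No edge is mapped to itself by the antipodal involution. -/
theorem AntipodeInvariant.image_neg_ne {Z : EmbeddedGraph Sphere2} (h : Z.AntipodeInvariant)
    {e : Set Sphere2} (he : e ∈ Z.edgeSet) : (fun x : Sphere2 => -x) '' e ≠ e := by
  intro hee
  obtain ⟨x, y, hxy⟩ := (Z.edge_mem_iff_exists_isLink e).1 he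
  obtain ⟨γ, hγ, hr, hV⟩ := Z.exists_path hxy
  have hx : x ∈ e ∩ Z.vertexSet := hV ▸ Or.inl rfl
  have hnx : -x ∈ ({x, y} : Set Sphere2) := by
    rw [← hV]
    exact ⟨hee ▸ ⟨x, hx.1, rfl⟩, h.1 _ hx.2⟩
  have hyx : y = -x := by
    rcases hnx with h1 | h1
    · exact absurd h1.symm (Sphere2.ne_neg x)
    · exact h1.symm
  have hinj : Function.Injective γ := by
    intro s t hst
    rcases hγ s t hst with h1 | ⟨rfl, rfl⟩ | ⟨rfl, rfl⟩
    · exact h1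
    · rw [γ.source, γ.target, hyx] at hst
      exact absurd hst (Sphere2.ne_neg x)
    · rw [γ.source, γ.target, hyx] at hst
      exact absurd hst.symm (Sphere2.ne_neg x)
  have hemb : Topology.IsEmbedding γ := (γ.continuous.isClosedEmbedding hinj).isEmbedding
  have hex : ∀ t, ∃ s, γ s = -γ t := by
    intro t
    have : -γ t ∈ Set.range γ := by
      rw [hr, ← hee]
      exact ⟨γ t, hr ▸ ⟨t, rfl⟩, rfl⟩
    exact this
  choose φ hφ using hex
  have hcont : Continuous φ := by
    rw [hemb.continuous_iff]
    have : γ ∘ φ = fun t => -γ t := funext hφ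
    rw [this]
    exact γ.continuous.neg
  obtain ⟨c, -, hc⟩ := exists_mem_Icc_isFixedPt (a := (0 : unitInterval)) (b := 1)
    hcont.continuousOn zero_le_one unitInterval.nonneg' unitInterval.le_one'
  have := hφ c
  rw [hc] at this
  exact Sphere2.ne_neg _ this

/-- The quotient `Z/g` of an antipodally symmetric graph on the sphere: the image of `Z` in the
projective plane, with the images of the vertices as vertices and the images of the edges as
edges. -/
def antipodeQuotient (Z : EmbeddedGraph Sphere2) (h : Z.AntipodeInvariant) :
    EmbeddedGraph ProjPlane where
  vertexSet := toProjPlane '' Z.vertexSet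
  IsLink e' x' y' := ∃ e x y, Z.IsLink e x y ∧
    toProjPlane '' e = e' ∧ toProjPlane x = x' ∧ toProjPlane y = y'
  edgeSet := (fun e => toProjPlane '' e) '' Z.edgeSet
  isLink_symm := by
    intro e' _
    exact ⟨fun x' y' ⟨e, x, y, hl, h1, h2, h3⟩ => ⟨e, y, x, hl.symm, h1, h3, h2⟩⟩
  eq_or_eq_of_isLink_of_isLink := by
    rintro _ _ _ _ _ ⟨e, x, y, hl, rfl, rfl, rfl⟩ ⟨f, a, b, hl', hfe, rfl, rfl⟩
    rcases h.eq_or_eq hl.edge_mem hl'.edge_mem hfe.symm with rfl | rfl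
    · rcases hl.left_eq_or_eq hl' with rfl | rfl
      · exact Or.inl rfl
      · exact Or.inr rfl
    · rcases hl.left_eq_or_eq (h.isLink_neg hl') with rfl | rfl
      · exact Or.inl (toProjPlane_neg _)
      · exact Or.inr (toProjPlane_neg _)
  edge_mem_iff_exists_isLink := by
    intro e'
    constructor
    · rintro ⟨e, he, rfl⟩
      obtain ⟨x, y, hxy⟩ := (Z.edge_mem_iff_exists_isLink e).1 he
      exact ⟨_, _, e, x, y, hxy, rfl, rfl, rfl⟩
    · rintro ⟨_, _, e, x, y, hxy, rfl, -, -⟩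
      exact ⟨e, hxy.edge_mem, rfl⟩
  left_mem_of_isLink := by
    rintro _ _ _ ⟨e, x, y, hxy, -, rfl, -⟩
    exact ⟨x, hxy.left_mem, rfl⟩
  finite_vertexSet := Z.finite_vertexSet.image _
  finite_edgeSet := Z.finite_edgeSet.image _
  exists_path := by
    rintro _ _ _ ⟨e, x, y, hxy, rfl, rfl, rfl⟩
    obtain ⟨γ, hγ, hr, hV⟩ := Z.exists_path hxy
    have hx : x ∈ e ∩ Z.vertexSet := hV ▸ Or.inl rfl
    have hy : y ∈ e ∩ Z.vertexSet := hV ▸ Or.inr rfl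
    refine ⟨γ.map continuous_toProjPlane, ?_, ?_, ?_⟩
    · intro s t hst
      rcases toProjPlane_eq_iff.1 hst with h1 | h1
      · exact hγ s t h1
      · have hs : γ s ∈ e := hr ▸ ⟨s, rfl⟩
        have ht : γ t ∈ e := hr ▸ ⟨t, rfl⟩
        have hsV : γ s ∈ Z.vertexSet :=
          Z.inter_subset hxy.edge_mem (h.2 e hxy.edge_mem) (h.image_neg_ne hxy.edge_mem).symm
            ⟨hs, γ t, ht, h1.symm⟩
        have htV : γ t ∈ Z.vertexSet := h.mem_of_neg (h1 ▸ hsV)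
        rcases Z.eq_zero_or_one γ hγ hr hV hsV with rfl | rfl <;>
          rcases Z.eq_zero_or_one γ hγ hr hV htV with rfl | rfl <;> simp
    · rw [← hr, ← Set.range_comp]
      rfl
    · ext p
      constructor
      · rintro ⟨⟨a, ha, rfl⟩, v, hv, hav⟩
        have haV : a ∈ Z.vertexSet := by
          rcases toProjPlane_eq_iff.1 hav with rfl | rfl
          · exact hv
          · exact h.mem_of_neg hv
        have : a ∈ ({x, y} : Set Sphere2) := hV ▸ ⟨ha, haV⟩
        rcases this with rfl | rfl
        · exact Or.inl rfl
        · exact Or.inr rfl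
      · rintro (rfl | rfl)
        · exact ⟨⟨x, hx.1, rfl⟩, x, hx.2, rfl⟩
        · exact ⟨⟨y, hy.1, rfl⟩, y, hy.2, rfl⟩
  inter_subset := by
    rintro _ _ ⟨e, he, rfl⟩ ⟨f, hf, rfl⟩ hne _ ⟨⟨a, ha, rfl⟩, b, hb, hba⟩
    refine ⟨a, ?_, rfl⟩
    by_contra haV
    rcases toProjPlane_eq_iff.1 hba.symm with rfl | rfl
    · exact hne (by rw [Z.eq_of_mem_inter he hf ha hb haV])
    · have := Z.eq_of_mem_inter he (h.2 f hf) ha ⟨b, hb, rfl⟩ haV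
      refine hne ?_
      simp only [this, Set.image_image, toProjPlane_neg]

end EmbeddedGraph

/-! Each antipodal pair of vertices has exactly one black member, so the set `B` of black vertices
is also the vertex set of `Z/g`. An edge of `Z` from black `b` to white `-c` becomes a dart from `b`
to `c`; its antipodal image is the reversed dart, and an edge of `Z/g` is a dart together with its
reversal. A perfect matching of `Z` is then a choice of one dart out of each vertex of `B` such that
one dart enters each vertex: an oriented cycle cover of `Z/g`.

Superimposing two perfect matchings of `Z/g` gives even cycles (a shared edge gives a 2-cycle), and
a fixed rule for two-colouring them orients them. Conversely, a cycle cover with only even cycles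
splits into two matchings. This is `card_cycleCover_eq`, so it remains to exclude odd cycles.

An odd cycle lifts to a path on the sphere from a point to its antipode. Two such paths always meet
up to sign (`Sphere2.exists_eq_or_eq_neg`), while distinct cycles of a cover are disjoint, so at
most one cycle is odd. As `B` has `2n` elements, the number of odd cycles is even, hence zero.

The crossing statement uses the double cover of the rotation group by unit quaternions. If the paths
never met up to sign, a point of the first path and its normalised cross product with a point of the
second would form a frame over a square. Passing to opposite sides turns the frame by half turns
about perpendicular axes. These rotations commute but their quaternion lifts anticommute, a
contradiction. -/

/-! ### Quaternion frames and their lifts -/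

open Quaternion in
/-- An element that commutes with two anticommuting square roots of `-1` is real. -/
theorem Quaternion.eq_re_of_commute {a c z : ℍ[ℝ]} (ha : a * a = -1) (hc : c * c = -1)
    (hac : a * c = -(c * a)) (h1 : z * a = a * z) (h2 : z * c = c * z) : z = (z.re : ℍ[ℝ]) := by
  -- A square root of `-1` is purely imaginary of norm 1; a nonzero real part would force the
  -- imaginary part to vanish, and then the square to be positive.
  have key : ∀ d : ℍ[ℝ], d * d = -1 → d.re = 0 ∧
      d.imI * d.imI + d.imJ * d.imJ + d.imK * d.imK = 1 := by
    intro d hd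
    rw [Quaternion.ext_iff] at hd
    simp only [re_mul, imI_mul, imJ_mul, imK_mul, re_neg, imI_neg, imJ_neg, imK_neg,
      re_one, imI_one, imJ_one, imK_one] at hd
    obtain ⟨e0, e1, e2, e3⟩ := hd
    have h0 : d.re = 0 := by
      by_contra h
      have f1 : d.imI = 0 := by
        have : d.re * d.imI = 0 := by linarith
        simpa [h] using this
      have f2 : d.imJ = 0 := by
        have : d.re * d.imJ = 0 := by linarith
        simpa [h] using this
      have f3 : d.imK = 0 := by
        have : d.re * d.imK = 0 := by linarith
        simpa [h] using this
      rw [f1, f2, f3] at e0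
      nlinarith [mul_self_nonneg d.re]
    refine ⟨h0, ?_⟩
    rw [h0] at e0
    linarith
  obtain ⟨a0, aa⟩ := key a ha
  obtain ⟨c0, cc⟩ := key c hc
  rw [Quaternion.ext_iff] at hac h1 h2
  simp only [re_mul, imI_mul, imJ_mul, imK_mul, re_neg, imI_neg, imJ_neg, imK_neg] at hac h1 h2
  rw [a0] at hac h1
  rw [c0] at hac h2
  obtain ⟨o, -, -, -⟩ := hac
  obtain ⟨-, p1, p2, p3⟩ := h1
  obtain ⟨-, q1, q2, q3⟩ := h2
  have o' : a.imI * c.imI + a.imJ * c.imJ + a.imK * c.imK = 0 := by linarith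
  -- Write `Im z` for the imaginary vector. It is parallel to `c`, which is orthogonal to `a`, so it
  -- is orthogonal to `a`; being also parallel to `a`, it vanishes.
  have par : z.imI * a.imI + z.imJ * a.imJ + z.imK * a.imK = 0 := by
    have r1 : z.imJ * c.imK = z.imK * c.imJ := by linarith
    have r2 : z.imK * c.imI = z.imI * c.imK := by linarith
    have r3 : z.imI * c.imJ = z.imJ * c.imI := by linarith
    linear_combination (z.imI * c.imI + z.imJ * c.imJ + z.imK * c.imK) * o'
      - (z.imI * a.imI + z.imJ * a.imJ + z.imK * a.imK) * cc
      + (a.imJ * c.imK - a.imK * c.imJ) * r1 + (a.imK * c.imI - a.imI * c.imK) * r2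
      + (a.imI * c.imJ - a.imJ * c.imI) * r3
  have r1 : z.imJ * a.imK = z.imK * a.imJ := by linarith
  have r2 : z.imK * a.imI = z.imI * a.imK := by linarith
  have r3 : z.imI * a.imJ = z.imJ * a.imI := by linarith
  ext
  · simp
  · simp only [imI_coe]
    linear_combination a.imI * par - z.imI * aa + a.imJ * r3 - a.imK * r2
  · simp only [imJ_coe]
    linear_combination a.imJ * par - z.imJ * aa + a.imK * r1 - a.imI * r3
  · simp only [imK_coe]
    linear_combination a.imK * par - z.imK * aa + a.imI * r2 - a.imJ * r1

/-- An element intertwining the quaternion frame generated by `a`, `c` with that generated by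
`a'`, `c'`. -/
def frameIntertwiner {R : Type*} [Ring R] (a' c' a c : R) : R :=
  1 - a' * a - c' * c - a' * c' * a * c

/-- The intertwiner is the sum of `g' * g⁻¹` over `g = 1, a, c, a * c`, with `g'` the matching
element of the other frame. Multiplication by a generator only permutes the summands. -/
theorem frameIntertwiner_mul {R : Type*} [Ring R] {a' c' a c : R} (ha' : a' * a' = -1)
    (hc' : c' * c' = -1) (hac' : a' * c' = -(c' * a')) (ha : a * a = -1) (hc : c * c = -1)
    (hac : a * c = -(c * a)) :
    frameIntertwiner a' c' a c * a = a' * frameIntertwiner a' c' a c ∧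
      frameIntertwiner a' c' a c * c = c' * frameIntertwiner a' c' a c := by
  unfold frameIntertwiner
  have hca : c * a = -(a * c) := by rw [hac, neg_neg]
  have hca' : c' * a' = -(a' * c') := by rw [hac', neg_neg]
  have e1 : ∀ x, a' * (a' * x) = -x := fun x => by rw [← mul_assoc, ha', neg_one_mul]
  have e2 : ∀ x, c' * (c' * x) = -x := fun x => by rw [← mul_assoc, hc', neg_one_mul]
  have e3 : ∀ x, c' * (a' * x) = -(a' * (c' * x)) := fun x => by
    rw [← mul_assoc, hca', neg_mul, mul_assoc]
  have e4 : ∀ x, a * (a * x) = -x := fun x => by rw [← mul_assoc, ha, neg_one_mul]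
  constructor <;>
  · simp only [mul_sub, sub_mul, mul_assoc, ha, hc, hca, e1, e2, e3, e4, mul_neg, neg_neg,
      mul_one, one_mul]
    abel

/-- All four summands `g * g⁻¹` are 1. By continuity the intertwiner of two nearby quaternion frames
is therefore nonzero. -/
theorem frameIntertwiner_self {R : Type*} [Ring R] {a c : R} (ha : a * a = -1)
    (hc : c * c = -1) (hac : a * c = -(c * a)) : frameIntertwiner a c a c = 4 := by
  have : a * c * a * c = -1 := by
    rw [hac, neg_mul, mul_assoc c a a, ha, neg_mul, mul_neg_one, neg_mul, neg_neg, hc]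
  rw [frameIntertwiner, this, ha, hc]
  norm_num

open Quaternion in
/-- A continuous family of quaternion frames over a closed ball is conjugate to the frame at the
centre by a continuous nowhere vanishing family of quaternions. -/
theorem exists_frame_lift {X : Type*} [NormedAddCommGroup X] [NormedSpace ℝ X] [ProperSpace X]
    {a c : X → ℍ[ℝ]} (hca : Continuous a) (hcc : Continuous c) (ha : ∀ x, a x * a x = -1)
    (hc : ∀ x, c x * c x = -1) (hac : ∀ x, a x * c x = -(c x * a x)) :
    ∃ q : X → ℍ[ℝ], Continuous q ∧ (∀ x, ‖x‖ ≤ 1 → q x ≠ 0) ∧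
      ∀ x, q x * a 0 = a x * q x ∧ q x * c 0 = c x * q x := by
  have hK : IsCompact (Metric.closedBall (0 : X) 1 ×ˢ Metric.closedBall (0 : X) 1) :=
    (isCompact_closedBall _ _).prod (isCompact_closedBall _ _)
  let G : X × X → ℍ[ℝ] := fun p => frameIntertwiner (a p.1) (c p.1) (a p.2) (c p.2)
  have hG : Continuous G := by
    unfold G frameIntertwiner
    fun_prop
  have hu := Metric.uniformContinuousOn_iff.1 (hK.uniformContinuousOn_of_continuous hG.continuousOn)
  -- The tolerance 4 is the distance from 0 to the value of `G` on the diagonal. With `N > 1 / δ`,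
  -- each ray is crossed in `N` steps shorter than `δ`, and the intertwiners of consecutive frames
  -- are multiplied together.
  obtain ⟨δ, hδ, hδG⟩ := hu 4 (by norm_num)
  have hne : ∀ x y, ‖x‖ ≤ 1 → ‖y‖ ≤ 1 → dist x y < δ → G (x, y) ≠ 0 := by
    intro x y hx hy hxy h0
    have h1 := hδG (x, y) ⟨by simpa using hx, by simpa using hy⟩ (y, y)
      ⟨by simpa using hy, by simpa using hy⟩ (by rw [Prod.dist_eq, dist_self]; exact max_lt hxy hδ)
    have h4 : G (y, y) = 4 := frameIntertwiner_self (ha y) (hc y) (hac y)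
    rw [h0, h4, dist_zero_left] at h1
    have : (4 : ℍ[ℝ]) = ((4 : ℝ) : ℍ[ℝ]) := by norm_cast
    rw [this, Quaternion.norm_coe] at h1
    norm_num at h1
  obtain ⟨N, hN⟩ := exists_nat_gt (1 / δ)
  have hN0 : (0 : ℝ) < N := lt_trans (by positivity) hN
  have step : ∀ k : ℕ, k ≤ N → ∃ q : X → ℍ[ℝ], Continuous q ∧ (∀ x, ‖x‖ ≤ 1 → q x ≠ 0) ∧
      ∀ x, q x * a 0 = a (((k : ℝ) / N) • x) * q x ∧ q x * c 0 = c (((k : ℝ) / N) • x) * q x := by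
    intro k
    induction k with
    | zero => exact fun _ => ⟨fun _ => 1, continuous_const, by simp, by simp⟩
    | succ k ih =>
      intro hk
      obtain ⟨q, hq, hq0, hqx⟩ := ih (by omega)
      refine ⟨fun x => G ((((k + 1 : ℕ) : ℝ) / N) • x, ((k : ℝ) / N) • x) * q x, ?_, ?_, ?_⟩
      · fun_prop
      · intro x hx
        have hsmul : ∀ j : ℕ, j ≤ N → ‖((j : ℝ) / N) • x‖ ≤ 1 := by
          intro j hj
          rw [norm_smul, Real.norm_of_nonneg (by positivity)]
          have : (j : ℝ) / N ≤ 1 := (div_le_one hN0).2 (by exact_mod_cast hj)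
          exact mul_le_one₀ this (norm_nonneg _) hx
        refine mul_ne_zero (hne _ _ (hsmul _ hk) (hsmul _ (by omega)) ?_) (hq0 x hx)
        rw [dist_eq_norm, ← sub_smul, norm_smul]
        have h1 : (((k + 1 : ℕ) : ℝ) / N - (k : ℝ) / N) = 1 / N := by push_cast; ring
        rw [h1, Real.norm_of_nonneg (by positivity)]
        calc 1 / (N : ℝ) * ‖x‖ ≤ 1 / N := mul_le_of_le_one_right (by positivity) hx
          _ < δ := by rwa [div_lt_comm₀ hN0 hδ]
      · intro x
        obtain ⟨g1, g2⟩ := frameIntertwiner_mul (ha ((((k + 1 : ℕ) : ℝ) / N) • x)) (hc _) (hac _)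
          (ha (((k : ℝ) / N) • x)) (hc _) (hac _)
        constructor
        · rw [mul_assoc, (hqx x).1, ← mul_assoc, ← mul_assoc, g1]
        · rw [mul_assoc, (hqx x).2, ← mul_assoc, ← mul_assoc, g2]
  obtain ⟨q, h1, h2, h3⟩ := step N le_rfl
  refine ⟨q, h1, h2, fun x => ?_⟩
  simpa [div_self hN0.ne'] using h3 x

/-- A real function on the line that has no zero in `[0, 1]` has the same sign at both ends. -/
theorem mul_pos_of_continuous_of_ne_zero {f : ℝ → ℝ} (hf : Continuous f)
    (h0 : ∀ t ∈ Set.Icc (0 : ℝ) 1, f t ≠ 0) : 0 < f 0 * f 1 := by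
  by_contra hcon
  have hle : f 0 * f 1 ≤ 0 := not_lt.1 hcon
  have key : (0 : ℝ) ∈ f '' Set.Icc 0 1 := by
    rcases le_total (f 0) 0 with h | h
    · refine intermediate_value_Icc zero_le_one hf.continuousOn ⟨h, ?_⟩
      have : f 0 < 0 := lt_of_le_of_ne h (h0 0 (by simp))
      nlinarith
    · refine intermediate_value_Icc' zero_le_one hf.continuousOn ⟨?_, h⟩
      have : 0 < f 0 := lt_of_le_of_ne h (h0 0 (by simp)).symm
      nlinarith
  obtain ⟨t, ht, h⟩ := key
  exact h0 t ht h

open Quaternion in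
/-- There is no continuous family of quaternion frames over the square for which passing to the
opposite side changes the signs in the two given ways. -/
theorem not_exists_frame_on_square {a c : ℝ × ℝ → ℍ[ℝ]} (hca : Continuous a) (hcc : Continuous c)
    (ha : ∀ x, a x * a x = -1) (hc : ∀ x, c x * c x = -1) (hac : ∀ x, a x * c x = -(c x * a x))
    (ha1 : ∀ t, a (1, t) = -a (0, t)) (hc1 : ∀ t, c (1, t) = -c (0, t))
    (ha2 : ∀ s, a (s, 1) = a (s, 0)) (hc2 : ∀ s, c (s, 1) = -c (s, 0)) : False := by
  obtain ⟨q, hq, hq0, hqx⟩ := exists_frame_lift hca hcc ha hc hac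
  have hn : ∀ s ∈ Set.Icc (0 : ℝ) 1, ∀ t ∈ Set.Icc (0 : ℝ) 1, q (s, t) ≠ 0 := by
    intro s hs t ht
    refine hq0 _ ?_
    -- The norm on the product is the maximum norm, so its closed unit ball contains the square.
    rw [Prod.norm_def]
    simp only [Real.norm_eq_abs, sup_le_iff, abs_le]
    exact ⟨⟨by linarith [hs.1], hs.2⟩, by linarith [ht.1], ht.2⟩
  set A := a 0
  set C := c 0
  have hA : A * A = -1 := ha 0
  have hC : C * C = -1 := hc 0
  have hAC : A * C = -(C * A) := hac 0
  have hCA : C * A = -(A * C) := by rw [hAC, neg_neg]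
  have hACA : A * C * A = C := by rw [hAC, neg_mul, mul_assoc, hA]; simp
  have hACC : A * C * C = -A := by rw [mul_assoc, hC]; simp
  have hAAC : A * (A * C) = -C := by rw [← mul_assoc, hA]; simp
  have hCAC : C * (A * C) = A := by rw [← mul_assoc, hCA, neg_mul, hACC, neg_neg]
  -- the two holonomies are real multiples of `A * C` and of `A`
  have inv_mul : ∀ {x y f e : ℍ[ℝ]}, x ≠ 0 → x * e = f * x → y * e = -f * y →
      x⁻¹ * y * e = -(e * (x⁻¹ * y)) := by
    intro x y f e hx h1 h2
    have h3 : e * x⁻¹ = x⁻¹ * f := by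
      rw [eq_inv_mul_iff_mul_eq₀ hx, ← mul_assoc, h1, mul_assoc, mul_inv_cancel₀ hx, mul_one]
    rw [mul_assoc, h2, ← mul_assoc e, h3]
    simp [mul_assoc]
  have inv_mul' : ∀ {x y f e : ℍ[ℝ]}, x ≠ 0 → x * e = f * x → y * e = f * y →
      x⁻¹ * y * e = e * (x⁻¹ * y) := by
    intro x y f e hx h1 h2
    have h3 : e * x⁻¹ = x⁻¹ * f := by
      rw [eq_inv_mul_iff_mul_eq₀ hx, ← mul_assoc, h1, mul_assoc, mul_inv_cancel₀ hx, mul_one]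
    rw [mul_assoc, h2, ← mul_assoc e, h3]
    simp [mul_assoc]
  have real : ∀ {x y : ℍ[ℝ]} {w : ℍ[ℝ]}, x ≠ 0 → w * w = -1 → ∀ {z : ℍ[ℝ]}, z = x⁻¹ * y * w →
      z = (z.re : ℍ[ℝ]) → y = x * (((-z.re : ℝ) : ℍ[ℝ]) * w) := by
    intro x y w hx hw z hz hre
    have : y = x * (-z * w) := by
      rw [hz]
      simp only [neg_mul, mul_assoc, hw, mul_neg, mul_one, neg_neg]
      rw [mul_inv_cancel_left₀ hx]
    rw [this, hre]
    simp
  -- `star` replaces the inverse so that the functions are continuous on the whole line, even where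
  -- `q` might vanish. On `[0, 1]` this only inserts a positive factor, so signs are unaffected.
  let u : ℝ → ℍ[ℝ] := fun t => star (q (0, t)) * q (1, t) * (A * C)
  let v : ℝ → ℍ[ℝ] := fun s => star (q (s, 0)) * q (s, 1) * A
  have hstar : ∀ x y w : ℍ[ℝ], x ≠ 0 →
      (star x * y * w) = ((normSq x : ℝ) : ℍ[ℝ]) * (x⁻¹ * y * w) := by
    intro x y w hx
    have : star x = ((normSq x : ℝ) : ℍ[ℝ]) * x⁻¹ := by
      rw [Quaternion.inv_def, ← Quaternion.coe_mul_eq_smul, ← mul_assoc, ← Quaternion.coe_mul,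
        mul_inv_cancel₀ (by simpa using hx)]
      simp
    rw [this]
    simp only [mul_assoc]
  have hu : ∀ t ∈ Set.Icc (0 : ℝ) 1, ∃ r : ℝ, q (1, t) = q (0, t) * (((-r : ℝ) : ℍ[ℝ]) * (A * C)) ∧
      (u t).re = normSq (q (0, t)) * r := by
    intro t ht
    have hx := hn 0 (by simp) t ht
    have g1 := inv_mul hx (hqx (0, t)).1 (by rw [(hqx (1, t)).1, ha1])
    have g2 := inv_mul hx (hqx (0, t)).2 (by rw [(hqx (1, t)).2, hc1])
    have hz := Quaternion.eq_re_of_commute (z := (q (0, t))⁻¹ * q (1, t) * (A * C)) hA hC hAC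
      (by
        rw [mul_assoc _ (A * C), hACA, ← mul_assoc A, ← neg_eq_iff_eq_neg.2 g1, neg_mul,
          mul_assoc _ A, hAAC, mul_neg, neg_neg])
      (by
        rw [mul_assoc _ (A * C), hACC, ← mul_assoc C, ← neg_eq_iff_eq_neg.2 g2, neg_mul,
          mul_assoc _ C, hCAC, mul_neg])
    refine ⟨_, real hx (by rw [mul_assoc, hCAC, hA]) rfl hz, ?_⟩
    simp only [u]
    rw [hstar _ _ _ hx, Quaternion.coe_mul_eq_smul, Quaternion.re_smul, smul_eq_mul]
  have hv : ∀ s ∈ Set.Icc (0 : ℝ) 1, ∃ r : ℝ, q (s, 1) = q (s, 0) * (((-r : ℝ) : ℍ[ℝ]) * A) ∧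
      (v s).re = normSq (q (s, 0)) * r := by
    intro s hs
    have hx := hn s hs 0 (by simp)
    have g1 := inv_mul' hx (hqx (s, 0)).1 (by rw [(hqx (s, 1)).1, ha2])
    have g2 := inv_mul hx (hqx (s, 0)).2 (by rw [(hqx (s, 1)).2, hc2])
    have hz := Quaternion.eq_re_of_commute (z := (q (s, 0))⁻¹ * q (s, 1) * A) hA hC hAC
      (by rw [← mul_assoc A, ← g1])
      (by
        rw [mul_assoc _ A, ← mul_assoc C, ← neg_eq_iff_eq_neg.2 g2, neg_mul, mul_assoc _ C, hCA,
          mul_neg, neg_neg])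
    refine ⟨_, real hx hA rfl hz, ?_⟩
    simp only [v]
    rw [hstar _ _ _ hx, Quaternion.coe_mul_eq_smul, Quaternion.re_smul, smul_eq_mul]
  have hpos : ∀ {x : ℍ[ℝ]}, x ≠ 0 → 0 < normSq x := fun {x} hx =>
    lt_of_le_of_ne normSq_nonneg (Ne.symm (by simpa using hx))
  have hune : 0 < (u 0).re * (u 1).re := by
    refine mul_pos_of_continuous_of_ne_zero (f := fun t => (u t).re) ?_ ?_
    · exact Quaternion.continuous_re.comp (by fun_prop)
    · intro t ht h
      obtain ⟨r, h1, h2⟩ := hu t ht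
      rw [h2, mul_eq_zero] at h
      rcases h with h | rfl
      · exact (hpos (hn 0 (by simp) t ht)).ne' h
      · exact hn 1 (by simp) t ht (by simp [h1])
  have hvne : 0 < (v 0).re * (v 1).re := by
    refine mul_pos_of_continuous_of_ne_zero (f := fun t => (v t).re) ?_ ?_
    · exact Quaternion.continuous_re.comp (by fun_prop)
    · intro t ht h
      obtain ⟨r, h1, h2⟩ := hv t ht
      rw [h2, mul_eq_zero] at h
      rcases h with h | rfl
      · exact (hpos (hn t ht 0 (by simp))).ne' h
      · exact hn t ht 1 (by simp) (by simp [h1])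
  obtain ⟨u0, hu0, hu0'⟩ := hu 0 (by simp)
  obtain ⟨u1, hu1, hu1'⟩ := hu 1 (by simp)
  obtain ⟨v0, hv0, hv0'⟩ := hv 0 (by simp)
  obtain ⟨v1, hv1, hv1'⟩ := hv 1 (by simp)
  have p00 := hpos (hn 0 (by simp) 0 (by simp))
  have p01 := hpos (hn 0 (by simp) 1 (by simp))
  have p10 := hpos (hn 1 (by simp) 0 (by simp))
  have huu : 0 < u0 * u1 := by
    rw [hu0', hu1'] at hune
    have : 0 < (normSq (q (0, 0)) * normSq (q (0, 1))) * (u0 * u1) := by linarith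
    exact (pos_iff_pos_of_mul_pos this).1 (by positivity)
  have hvv : 0 < v0 * v1 := by
    rw [hv0', hv1'] at hvne
    have : 0 < (normSq (q (0, 0)) * normSq (q (1, 0))) * (v0 * v1) := by linarith
    exact (pos_iff_pos_of_mul_pos this).1 (by positivity)
  -- The corner is reached in two ways: the holonomies multiply to `A * (A * C) = -C` one way and to
  -- `A * C * A = C` the other. The real coefficients have the same sign, as neither `u` nor `v`
  -- changes sign.
  have e1 : q (1, 1) = q (0, 0) * (((v0 * u1 : ℝ) : ℍ[ℝ]) * -C) := by
    rw [hu1, hv0, mul_assoc]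
    congr 1
    rw [← hAAC]
    simp only [Quaternion.coe_mul_eq_smul, smul_mul_assoc, mul_smul_comm, smul_smul]
    congr 1
    ring
  have e2 : q (1, 1) = q (0, 0) * (((v1 * u0 : ℝ) : ℍ[ℝ]) * C) := by
    rw [hv1, hu0, mul_assoc]
    congr 1
    nth_rw 2 [← hACA]
    simp only [Quaternion.coe_mul_eq_smul, smul_mul_assoc, mul_smul_comm, smul_smul]
    congr 1
    ring
  have h00 := hn 0 (by simp) 0 (by simp)
  have e3 := mul_left_cancel₀ h00 (e1.symm.trans e2)
  have hC0 : C ≠ 0 := by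
    rintro h
    rw [h] at hC
    simp at hC
  rw [mul_neg, ← neg_mul] at e3
  have e4 := mul_right_cancel₀ hC0 e3
  have e5 : -(v0 * u1) = v1 * u0 := by
    rw [← Quaternion.coe_neg] at e4
    exact Quaternion.coe_injective e4
  have : v0 * v1 * (u0 * u1) = -(v0 * u1) ^ 2 := by
    linear_combination (-(v0 * u1)) * e5
  nlinarith [mul_pos hvv huu, sq_nonneg (v0 * u1)]

/-! ### Crossing of antipodal paths on the sphere -/

/-- A point of the sphere as a purely imaginary quaternion. -/
noncomputable def Sphere2.toQuaternion (x : Sphere2) : Quaternion ℝ :=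
  ⟨0, x.1 0, x.1 1, x.1 2⟩

@[simp]
theorem Sphere2.toQuaternion_re (x : Sphere2) : x.toQuaternion.re = 0 := rfl

@[simp]
theorem Sphere2.toQuaternion_imI (x : Sphere2) : x.toQuaternion.imI = x.1 0 := rfl

@[simp]
theorem Sphere2.toQuaternion_imJ (x : Sphere2) : x.toQuaternion.imJ = x.1 1 := rfl

@[simp]
theorem Sphere2.toQuaternion_imK (x : Sphere2) : x.toQuaternion.imK = x.1 2 := rfl

open Quaternion in
theorem Sphere2.continuous_toQuaternion : Continuous Sphere2.toQuaternion := by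
  have h : Sphere2.toQuaternion = fun x : Sphere2 =>
      Quaternion.linearIsometryEquivTuple.symm (WithLp.toLp 2 ![0, x.1 0, x.1 1, x.1 2]) := rfl
  rw [h]
  refine Quaternion.linearIsometryEquivTuple.symm.continuous.comp
    ((PiLp.continuous_toLp 2 _).comp (continuous_pi fun i => ?_))
  fin_cases i
  · exact continuous_const
  all_goals exact (EuclideanSpace.proj _).continuous.comp continuous_subtype_val

theorem Sphere2.toQuaternion_neg (x : Sphere2) : (-x).toQuaternion = -x.toQuaternion := by
  ext <;> simp

theorem Sphere2.sum_sq (x : Sphere2) : x.1 0 * x.1 0 + x.1 1 * x.1 1 + x.1 2 * x.1 2 = 1 := by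
  have h : ‖(x : EuclideanSpace ℝ (Fin 3))‖ ^ 2 = 1 := by simp
  rw [EuclideanSpace.norm_sq_eq, Fin.sum_univ_three] at h
  simp only [Real.norm_eq_abs, sq_abs] at h
  linarith

open Quaternion in
theorem Sphere2.toQuaternion_mul_self (x : Sphere2) : x.toQuaternion * x.toQuaternion = -1 := by
  have := x.sum_sq
  ext
  · simp only [re_mul, toQuaternion_re, toQuaternion_imI, toQuaternion_imJ, toQuaternion_imK,
      re_neg, re_one]
    linarith
  all_goals
    simp
    try ring

open Quaternion in
/-- Two points of the sphere whose quaternions commute are equal or antipodal. -/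
theorem Sphere2.eq_or_eq_neg_of_commute {x y : Sphere2}
    (h : x.toQuaternion * y.toQuaternion = y.toQuaternion * x.toQuaternion) :
    x = y ∨ x = -y := by
  have hx := x.toQuaternion_mul_self
  have hy := y.toQuaternion_mul_self
  -- Both squares are `-1`, so the difference of squares factors to zero, and quaternions have no
  -- zero divisors.
  have h1 : (x.toQuaternion - y.toQuaternion) * (x.toQuaternion + y.toQuaternion) = 0 := by
    rw [sub_mul, mul_add, mul_add, hx, hy, h]
    abel
  have inj : ∀ {x y : Sphere2}, x.toQuaternion = y.toQuaternion → x = y := by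
    intro x y h
    rw [Quaternion.ext_iff] at h
    ext i
    fin_cases i
    · exact h.2.1
    · exact h.2.2.1
    · exact h.2.2.2
  rcases mul_eq_zero.1 h1 with h2 | h2
  · exact Or.inl (inj (sub_eq_zero.1 h2))
  · refine Or.inr (inj ?_)
    rw [Sphere2.toQuaternion_neg]
    exact eq_neg_of_add_eq_zero_left h2

-- Conjugation negates the commutator, which is therefore purely imaginary (twice the cross
-- product).
open Quaternion in
theorem Sphere2.commutator_mul_self (x y : Sphere2) :
    (x.toQuaternion * y.toQuaternion - y.toQuaternion * x.toQuaternion) *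
      (x.toQuaternion * y.toQuaternion - y.toQuaternion * x.toQuaternion) =
      -((normSq (x.toQuaternion * y.toQuaternion - y.toQuaternion * x.toQuaternion) : ℝ) :
        ℍ[ℝ]) := by
  have hs : star (x.toQuaternion * y.toQuaternion - y.toQuaternion * x.toQuaternion) =
      -(x.toQuaternion * y.toQuaternion - y.toQuaternion * x.toQuaternion) := by
    have : ∀ z : Sphere2, star z.toQuaternion = -z.toQuaternion := fun z => by
      ext <;> simp
    rw [star_sub, star_mul, star_mul, this, this]
    simp
  rw [← Quaternion.self_mul_star, hs, mul_neg, neg_neg]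

open Quaternion in
/-- Two paths on the sphere, each from a point to its antipode, meet up to antipodes. -/
theorem Sphere2.exists_eq_or_eq_neg {x y : Sphere2} (α : Path x (-x)) (β : Path y (-y)) :
    ∃ s t, α s = β t ∨ α s = -β t := by
  by_contra hcon
  push Not at hcon
  let a : ℝ × ℝ → ℍ[ℝ] := fun p => (α.extend p.1).toQuaternion
  let b : ℝ × ℝ → ℍ[ℝ] := fun p => (β.extend p.2).toQuaternion
  let w : ℝ × ℝ → ℍ[ℝ] := fun p => a p * b p - b p * a p
  have hca : Continuous a :=
    Sphere2.continuous_toQuaternion.comp (α.continuous_extend.comp continuous_fst)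
  have hcb : Continuous b :=
    Sphere2.continuous_toQuaternion.comp (β.continuous_extend.comp continuous_snd)
  have hcw : Continuous w := by fun_prop
  have hw0 : ∀ p, ‖w p‖ ≠ 0 := by
    intro p h
    have h1 := Sphere2.eq_or_eq_neg_of_commute (sub_eq_zero.1 (norm_eq_zero.1 h))
    have h2 := hcon (Set.projIcc 0 1 zero_le_one p.1) (Set.projIcc 0 1 zero_le_one p.2)
    exact h1.elim h2.1 h2.2
  have haa : ∀ p, a p * a p = -1 := fun p => Sphere2.toQuaternion_mul_self _
  have hww : ∀ p, w p * w p = -((‖w p‖ * ‖w p‖ : ℝ) : ℍ[ℝ]) := fun p => by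
    rw [← Quaternion.normSq_eq_norm_mul_self]
    exact Sphere2.commutator_mul_self _ _
  have haw : ∀ p, a p * w p = -(w p * a p) := fun p => by
    simp only [w, mul_sub, sub_mul]
    rw [← mul_assoc, haa, mul_assoc (b p), haa]
    simp [mul_assoc, sub_eq_add_neg]
  -- Crossing in the first variable negates `a`, hence also `w`; crossing in the second negates `b`,
  -- hence `w` but not `a`.
  refine not_exists_frame_on_square (a := a) (c := fun p => ‖w p‖⁻¹ • w p) hca
    ((hcw.norm.inv₀ hw0).smul hcw) haa ?_ ?_ ?_ ?_ ?_ ?_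
  · intro p
    simp only [smul_mul_assoc, mul_smul_comm, smul_smul, hww, smul_neg]
    rw [Quaternion.smul_coe]
    have := hw0 p
    field_simp
    simp
  · intro p
    simp only [smul_mul_assoc, mul_smul_comm, haw, smul_neg]
  · intro t
    simp [a, Sphere2.toQuaternion_neg]
  · intro t
    have h1 : w (1, t) = -w (0, t) := by
      simp [w, a, b, Sphere2.toQuaternion_neg]
      abel
    simp [h1]
  · intro t
    simp [a]
  · intro t
    have h1 : w (t, 1) = -w (t, 0) := by
      simp [w, a, b, Sphere2.toQuaternion_neg]
      abel
    simp [h1]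

/-! ### Two-colourings and orbits of odd period -/

/-- A function to `Bool` that changes along related pairs. -/
def IsTwoColoring {B : Type*} (R : B → B → Prop) (p : B → Bool) : Prop :=
  ∀ b c, R b c → p c = !p b

open Classical in
/-- A two-colouring chosen once for each relation that has one. -/
noncomputable def chosenColoring {B : Type*} (R : B → B → Prop) : B → Bool :=
  if h : ∃ p, IsTwoColoring R p then h.choose else fun _ => false

theorem isTwoColoring_chosenColoring {B : Type*} {R : B → B → Prop}
    (h : ∃ p, IsTwoColoring R p) : IsTwoColoring R (chosenColoring R) := by
  rw [chosenColoring, dif_pos h]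
  exact h.choose_spec

/-- An antisymmetric comparison of a label with a different label. -/
theorem exists_comparison_of_ne {B O : Type*} (q : B → O) (τ : B → B)
    (h2 : ∀ b, q (τ b) ≠ q b) :
    ∃ f : O → O → Bool, ∀ b, f (q (τ b)) (q b) = !f (q b) (q (τ b)) := by
  classical
  refine ⟨fun x y => decide (WellOrderingRel x y), fun b => ?_⟩
  rcases trichotomous_of WellOrderingRel (q b) (q (τ b)) with h | h | h
  · have := asymm h
    simp [h, this]
  · exact absurd h.symm (h2 b)
  · have := asymm h
    simp [h, this]

/-- A permutation without points of odd period is two-colourable. -/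
theorem Equiv.Perm.exists_coloring {B : Type*} (σ : Equiv.Perm B)
    (h : ∀ (b : B) (k : ℤ), Odd k → (σ ^ k) b ≠ b) : ∃ p : B → Bool, ∀ b, p (σ b) = !p b := by
  -- Label points by their `σ ^ 2`-orbits. Without odd periods, `b` and `σ b` have different labels,
  -- and `σ` swaps the two; the colour says which of them comes first in a fixed order.
  have hq : ∀ b c, (Quotient.mk (SameCycle.setoid (σ ^ 2)) b =
      Quotient.mk (SameCycle.setoid (σ ^ 2)) c) ↔ (σ ^ 2).SameCycle b c :=
    fun b c => Quotient.eq (r := SameCycle.setoid (σ ^ 2))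
  have e1 : ∀ b, Quotient.mk (SameCycle.setoid (σ ^ 2)) (σ (σ b)) =
      Quotient.mk (SameCycle.setoid (σ ^ 2)) b := fun b => by
    rw [hq]
    exact (SameCycle.symm ⟨1, by simp [sq]⟩)
  obtain ⟨f, hf⟩ := exists_comparison_of_ne
    (Quotient.mk (SameCycle.setoid (σ ^ 2))) σ
    (fun b hb => by
      obtain ⟨k, hk⟩ := ((hq _ _).1 hb).symm
      refine h b (2 * k - 1) ⟨k - 1, by ring⟩ ?_
      have h3 : σ ^ (2 * k - 1) = σ⁻¹ * (σ ^ 2) ^ k := by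
        rw [← zpow_natCast, ← zpow_mul, ← zpow_neg_one, ← zpow_add]
        congr 1
        push_cast
        ring
      rw [h3, mul_apply, hk]
      simp)
  refine ⟨fun b => f (Quotient.mk _ b) (Quotient.mk _ (σ b)), fun b => ?_⟩
  simp only [e1]
  exact hf b

/-- The union of two perfect matchings is two-colourable. -/
theorem exists_coloring_of_two_involutions {B : Type*} {τ₁ τ₂ : B → B}
    (h₁ : Function.Involutive τ₁) (h₂ : Function.Involutive τ₂) (f₁ : ∀ b, τ₁ b ≠ b)
    (f₂ : ∀ b, τ₂ b ≠ b) : ∃ p : B → Bool, ∀ b, p (τ₁ b) = !p b ∧ p (τ₂ b) = !p b := by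
  let g₁ : Equiv.Perm B := h₁.toPerm
  let g₂ : Equiv.Perm B := h₂.toPerm
  have i₁ : g₁⁻¹ = g₁ := rfl
  have i₂ : g₂⁻¹ = g₂ := rfl
  -- Label points by orbits of `π`. Both involutions send the orbit of `b` to that of `τ₁ b`. If
  -- these coincided, `τ₁` would act on the orbit as a reflection `j ↦ k - j` of exponents, giving a
  -- fixed point of `τ₁` for even `k` and of `τ₂` for odd `k`.
  let π : Equiv.Perm B := g₂ * g₁
  have hq : ∀ b c, (Quotient.mk (Equiv.Perm.SameCycle.setoid π) b =
      Quotient.mk (Equiv.Perm.SameCycle.setoid π) c) ↔ π.SameCycle b c :=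
    fun b c => Quotient.eq (r := Equiv.Perm.SameCycle.setoid π)
  have conj : ∀ k : ℤ, g₁ * π ^ k = π ^ (-k) * g₁ := by
    intro k
    have : g₁ * π * g₁⁻¹ = π⁻¹ := by
      simp only [π, mul_inv_rev, i₁, i₂]
      have : g₁ * g₁ = 1 := by nth_rw 1 [← i₁]; simp
      rw [mul_assoc, mul_assoc, this, mul_one]
    have h3 : g₁ * π ^ k * g₁⁻¹ = π ^ (-k) := by rw [← conj_zpow, this, inv_zpow']
    rw [← h3]
    simp
  obtain ⟨f, hf⟩ := exists_comparison_of_ne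
    (Quotient.mk (Equiv.Perm.SameCycle.setoid π)) τ₁
    (fun b hb => by
      obtain ⟨k, hk⟩ := ((hq _ _).1 hb).symm
      have key : ∀ j : ℤ, τ₁ ((π ^ j) b) = (π ^ (k - j)) b := by
        intro j
        have h3 : g₁ ((π ^ j) b) = (π ^ (-j)) (g₁ b) := by
          rw [← Equiv.Perm.mul_apply, conj, Equiv.Perm.mul_apply]
        have h4 : (π ^ k) b = g₁ b := hk
        change g₁ ((π ^ j) b) = _
        rw [h3, ← h4, ← Equiv.Perm.mul_apply, ← zpow_add]
        congr 2
        ring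
      rcases Int.even_or_odd' k with ⟨j, rfl | rfl⟩
      · refine f₁ ((π ^ j) b) ?_
        rw [key]
        congr 2
        ring
      · refine f₂ (τ₁ ((π ^ j) b)) ?_
        have h5 : τ₂ (τ₁ ((π ^ j) b)) = (π ^ (1 + j)) b := by
          rw [zpow_add, zpow_one]
          rfl
        rw [h5, key]
        congr 2
        ring)
  have e2 : ∀ b, Quotient.mk (Equiv.Perm.SameCycle.setoid π) (τ₂ b) =
      Quotient.mk (Equiv.Perm.SameCycle.setoid π) (τ₁ b) := fun b => by
    rw [hq]
    exact Equiv.Perm.SameCycle.symm ⟨1, by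
      rw [zpow_one]
      change τ₂ (τ₁ (τ₁ b)) = _
      rw [h₁]⟩
  have e3 : ∀ b, Quotient.mk (Equiv.Perm.SameCycle.setoid π) (τ₁ (τ₂ b)) =
      Quotient.mk (Equiv.Perm.SameCycle.setoid π) b := fun b => by
    rw [hq]
    exact ⟨1, by
      rw [zpow_one]
      change τ₂ (τ₁ (τ₁ (τ₂ b))) = _
      rw [h₁, h₂]⟩
  refine ⟨fun b => f (Quotient.mk _ b) (Quotient.mk _ (τ₁ b)), fun b => ⟨?_, ?_⟩⟩
  · simp only [h₁ b]
    exact hf b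
  · simp only [e2, e3]
    exact hf b

/-- A permutation of a finite set of odd cardinality has a point of odd period. -/
theorem Equiv.Perm.exists_odd_pow_fixed {B : Type*} [Finite B] (σ : Equiv.Perm B)
    (hB : Odd (Nat.card B)) : ∃ k : ℕ, Odd k ∧ ∃ b, (σ ^ k) b = b := by
  classical
  have := Fintype.ofFinite B
  -- With `m` the odd part of the order, `σ ^ m` has 2-power order, so its number of fixed points
  -- has the parity of the whole set.
  obtain ⟨k, m, hm, h⟩ := Nat.exists_eq_two_pow_mul_odd (orderOf_pos σ).ne'
  refine ⟨m, hm, ?_⟩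
  have : Fact (Nat.Prime 2) := ⟨Nat.prime_two⟩
  have h1 : (σ ^ m) ^ 2 ^ k = 1 := by
    rw [← pow_mul, mul_comm, ← h, pow_orderOf_eq_one]
  have h2 : Fintype.card B ≡ Fintype.card (Function.fixedPoints ⇑(σ ^ m)) [MOD 2] :=
    Equiv.Perm.card_fixedPoints_modEq (f := (MulAction.toEndHom (σ ^ m) : Function.End B))
      (p := 2) (n := k) (by rw [← map_pow, h1, map_one])
  have h3 : 0 < Fintype.card (Function.fixedPoints ⇑(σ ^ m)) := by
    rw [Nat.card_eq_fintype_card] at hB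
    rcases Nat.eq_zero_or_pos (Fintype.card (Function.fixedPoints ⇑(σ ^ m))) with h4 | h4
    · rw [h4] at h2
      obtain ⟨j, hj⟩ := hB
      rw [Nat.ModEq] at h2
      omega
    · exact h4
  obtain ⟨b, hb⟩ := Fintype.card_pos_iff.1 h3
  exact ⟨b, hb⟩

/-- If a permutation of a finite set of even cardinality has a point of odd period, then it has a
second such point in another orbit. -/
theorem Equiv.Perm.exists_second_odd_orbit {B : Type*} [Finite B] (σ : Equiv.Perm B)
    (hB : Even (Nat.card B)) {b : B} {k : ℤ} (hk : Odd k) (hb : (σ ^ k) b = b) :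
    ∃ c, ¬ σ.SameCycle b c ∧ ∃ j : ℕ, Odd j ∧ (σ ^ j) c = c := by
  classical
  have := Fintype.ofFinite B
  let τ : Equiv.Perm {c // ¬ σ.SameCycle b c} := σ.subtypePerm (fun c => by simp)
  let ρ : Equiv.Perm {c // σ.SameCycle b c} := σ.subtypePerm (fun c => by simp)
  have hρ : ∀ (j : ℤ) (c), ((ρ ^ j) c : B) = (σ ^ j) c := fun j c => by
    rw [Equiv.Perm.subtypePerm_zpow]
    rfl
  have hodd : Odd (Nat.card {c // σ.SameCycle b c}) := by
    by_contra hev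
    have hρk : ρ ^ k = 1 := by
      ext ⟨c, i, hi⟩
      rw [hρ]
      change (σ ^ k) c = c
      rw [← hi, ← Equiv.Perm.mul_apply, ← zpow_add, add_comm, zpow_add, Equiv.Perm.mul_apply, hb]
    have hord : Odd (orderOf ρ) := by
      have h1 : (orderOf ρ : ℤ) ∣ k := orderOf_dvd_iff_zpow_eq_one.2 hρk
      obtain ⟨d, hd⟩ := h1
      rw [hd, Int.odd_mul] at hk
      exact_mod_cast hk.1
    -- Powers of `ρ` that agree at `b` agree on its whole orbit because they commute, so evaluation
    -- at `b` is a bijection. The orbit thus has odd size, and so does its complement, which must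
    -- contain an odd period.
    have hcyc : Nat.card {c // σ.SameCycle b c} = orderOf ρ := by
      refine (Nat.card_congr (Equiv.ofBijective
        (fun g : Subgroup.zpowers ρ => (g : Equiv.Perm _) ⟨b, .refl _ _⟩) ⟨?_, ?_⟩)).symm.trans
          (Nat.card_zpowers ρ)
      · rintro ⟨g, i, rfl⟩ ⟨g', j, rfl⟩ hij
        have hij' := congrArg Subtype.val hij
        simp only [hρ] at hij'
        ext ⟨c, l, hl⟩
        simp only [hρ]
        rw [← hl, ← Equiv.Perm.mul_apply, ← Equiv.Perm.mul_apply, ← zpow_add, ← zpow_add,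
          add_comm, zpow_add, add_comm, zpow_add, Equiv.Perm.mul_apply, hij', Equiv.Perm.mul_apply]
      · rintro ⟨c, l, hl⟩
        exact ⟨⟨ρ ^ l, l, rfl⟩, Subtype.ext (by simp only [hρ]; exact hl)⟩
    exact hev (hcyc ▸ hord)
  have hodd' : Odd (Nat.card {c // ¬ σ.SameCycle b c}) := by
    have h1 : Nat.card B = Nat.card {c // σ.SameCycle b c} + Nat.card {c // ¬ σ.SameCycle b c} := by
      rw [← Nat.card_sum]
      exact Nat.card_congr (Equiv.sumCompl _).symm
    rw [h1] at hB
    exact (Nat.even_add'.1 hB).1 hodd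
  obtain ⟨j, hj, ⟨c, hc⟩, hjc⟩ := τ.exists_odd_pow_fixed hodd'
  refine ⟨c, hc, j, hj, ?_⟩
  rw [Equiv.Perm.subtypePerm_pow] at hjc
  exact congrArg Subtype.val hjc

/-! ### Cycle covers and pairs of matchings -/

section Darts

/-- A choice of an outgoing dart at every vertex such that exactly one dart enters every vertex:
an oriented cycle cover. -/
def IsCycleCover {B E : Type*} (s t : E → B) (ε : B → E) : Prop :=
  (∀ b, s (ε b) = b) ∧ Function.Bijective fun b => t (ε b)

/-- A choice of an outgoing dart at every vertex that is compatible with the reversal `r` of darts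
and contains no loop: a perfect matching. -/
def IsDartMatching {B E : Type*} (s t : E → B) (r : E → E) (μ : B → E) : Prop :=
  (∀ b, s (μ b) = b) ∧ ∀ b, t (μ b) ≠ b ∧ μ (t (μ b)) = r (μ b)

theorem IsDartMatching.involutive {B E : Type*} {s t : E → B} {r : E → E}
    (htr : ∀ e, t (r e) = s e) {μ : B → E}
    (h : IsDartMatching s t r μ) : Function.Involutive fun b => t (μ b) := fun b => by
  simp only [(h.2 b).2, htr, h.1]

/-- The relation joining a vertex to its partners in two matchings. -/
def matchingsRel {B E : Type*} (t : E → B) (μ ν : B → E) (b c : B) : Prop :=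
  c = t (μ b) ∨ c = t (ν b)

/-- The relation joining a vertex to its neighbours in a cycle cover. -/
def coverRel {B E : Type*} (t : E → B) (ε : B → E) (b c : B) : Prop :=
  c = t (ε b) ∨ b = t (ε c)

/-- The cycle cover that uses two matchings alternately. -/
def alternate {B E : Type*} (p : B → Bool) (μ ν : B → E) (b : B) : E :=
  bif p b then μ b else ν b

theorem exists_isTwoColoring_matchingsRel {B E : Type*} {s t : E → B} {r : E → E}
    (htr : ∀ e, t (r e) = s e) {μ ν : B → E} (hμ : IsDartMatching s t r μ)
    (hν : IsDartMatching s t r ν) : ∃ p, IsTwoColoring (matchingsRel t μ ν) p := by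
  obtain ⟨p, hp⟩ := exists_coloring_of_two_involutions (hμ.involutive htr) (hν.involutive htr)
    (fun b => (hμ.2 b).1) (fun b => (hν.2 b).1)
  refine ⟨p, ?_⟩
  rintro b c (rfl | rfl)
  · exact (hp b).1
  · exact (hp b).2

/-- Both partner maps swap the colours, so following `μ` from one colour and `ν` from the other
enters each vertex once. The cover still determines the adjacency relation, which is what allows the
colouring to be recovered from it. -/
theorem isCycleCover_alternate {B E : Type*} {s t : E → B} {r : E → E}
    (htr : ∀ e, t (r e) = s e) {μ ν : B → E} (hμ : IsDartMatching s t r μ)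
    (hν : IsDartMatching s t r ν) {p : B → Bool} (hp : IsTwoColoring (matchingsRel t μ ν) p) :
    IsCycleCover s t (alternate p μ ν) ∧
      coverRel t (alternate p μ ν) = matchingsRel t μ ν := by
  have iμ := hμ.involutive htr
  have iν := hν.involutive htr
  have p1 : ∀ b, p (t (μ b)) = !p b := fun b => hp _ _ (Or.inl rfl)
  have p2 : ∀ b, p (t (ν b)) = !p b := fun b => hp _ _ (Or.inr rfl)
  have et : ∀ b, p b = true → alternate p μ ν b = μ b := fun b h => by simp [alternate, h]
  have ef : ∀ b, p b = false → alternate p μ ν b = ν b := fun b h => by simp [alternate, h]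
  have pa : ∀ b, p (t (alternate p μ ν b)) = !p b := fun b => by
    cases h : p b
    · rw [ef b h, p2, h]
    · rw [et b h, p1, h]
  refine ⟨⟨fun b => ?_, fun b c hbc => ?_, fun c => ?_⟩, ?_⟩
  · cases h : p b
    · rw [ef b h, hν.1]
    · rw [et b h, hμ.1]
  · have h1 : p b = p c := by
      have := congrArg p hbc
      simpa only [pa, Bool.not_inj_iff] using this
    cases h : p c
    · simp only [ef b (h1.trans h), ef c h] at hbc
      exact iν.injective hbc
    · simp only [et b (h1.trans h), et c h] at hbc
      exact iμ.injective hbc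
  · cases h : p c
    · refine ⟨t (μ c), ?_⟩
      simp only
      rw [et _ (by rw [p1, h]; rfl)]
      exact iμ c
    · refine ⟨t (ν c), ?_⟩
      simp only
      rw [ef _ (by rw [p2, h]; rfl)]
      exact iν c
  · ext b c
    constructor
    · rintro (rfl | rfl)
      · cases h : p b
        · exact Or.inr (by rw [ef b h])
        · exact Or.inl (by rw [et b h])
      · cases h : p c
        · exact Or.inr (by rw [ef c h]; exact (iν c).symm)
        · exact Or.inl (by rw [et c h]; exact (iμ c).symm)
    · rintro (rfl | rfl)
      · cases h : p b
        · refine Or.inr ?_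
          rw [et _ (by rw [p1, h]; rfl)]
          exact (iμ b).symm
        · exact Or.inl (by rw [et b h])
      · cases h : p b
        · exact Or.inl (by rw [ef b h])
        · refine Or.inr ?_
          rw [ef _ (by rw [p2, h]; rfl)]
          exact (iν b).symm

/-- A matching is determined by its darts at one colour: the dart at any other vertex is the
reversal of the dart at its partner. -/
theorem eq_of_alternate_eq {B E : Type*} {s t : E → B} {r : E → E}
    {μ μ' : B → E} (hμ : IsDartMatching s t r μ) (hμ' : IsDartMatching s t r μ')
    (htr : ∀ e, t (r e) = s e) {p : B → Bool} {x : Bool} (hp : ∀ b, p (t (μ b)) = !p b)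
    (h : ∀ b, p b = x → μ b = μ' b) : μ = μ' := by
  funext b
  by_cases hb : p b = x
  · exact h b hb
  · have hc : p (t (μ b)) = x := by
      rw [hp]
      cases x <;> simpa using hb
    have h1 := h _ hc
    have h2 : t (μ (t (μ b))) = b := hμ.involutive htr b
    have h3 := (hμ.2 (t (μ b))).2
    have h4 := (hμ'.2 (t (μ b))).2
    rw [← h1, h2] at h4
    rw [h2] at h3
    rw [h3, h4]

/-- The matching formed by the darts of a cycle cover that leave vertices of one colour. -/
theorem isDartMatching_half {B E : Type*} {s t : E → B} {r : E → E} (hrr : ∀ e, r (r e) = e)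
    (hsr : ∀ e, s (r e) = t e) (htr : ∀ e, t (r e) = s e) {ε : B → E} {σ : Equiv.Perm B}
    (hs : ∀ b, s (ε b) = b) (hσ : ∀ b, t (ε b) = σ b) {p : B → Bool} (hp : ∀ b, p (σ b) = !p b) :
    IsDartMatching s t r (alternate p ε fun b => r (ε (σ.symm b))) := by
  have hp' : ∀ b, p (σ.symm b) = !p b := fun b => by
    have := hp (σ.symm b)
    rw [σ.apply_symm_apply] at this
    rw [this, Bool.not_not]
  have key : ∀ b, ∀ x : Bool, p b = x → t (alternate p ε (fun b => r (ε (σ.symm b))) b) =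
      bif x then σ b else σ.symm b := by
    intro b x h
    cases x <;> simp [alternate, h, hσ, htr, hs]
  refine ⟨fun b => ?_, fun b => ⟨fun h => ?_, ?_⟩⟩
  · cases h : p b
    · simp [alternate, h, hsr, hσ]
    · simp [alternate, h, hs]
  · have h1 : p (t (alternate p ε (fun b => r (ε (σ.symm b))) b)) = !p b := by
      cases h : p b <;> rw [key b _ h] <;> simp [hp, hp', h]
    rw [h] at h1
    simp at h1
  · cases h : p b <;> rw [key b _ h] <;> simp [alternate, hp, hp', h, hrr]

/-- If the vertices of every cycle cover can be two-coloured, then the cycle covers are as many as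
the pairs of perfect matchings. -/
theorem card_cycleCover_eq {B E : Type*} {s t : E → B} {r : E → E} (hrr : ∀ e, r (r e) = e)
    (hsr : ∀ e, s (r e) = t e) (htr : ∀ e, t (r e) = s e)
    (h : ∀ ε, IsCycleCover s t ε → ∃ p, IsTwoColoring (coverRel t ε) p) :
    Nat.card {ε // IsCycleCover s t ε} = Nat.card {μ // IsDartMatching s t r μ} ^ 2 := by
  rw [sq, ← Nat.card_prod]
  have hcol : ∀ x : {μ // IsDartMatching s t r μ} × {μ // IsDartMatching s t r μ},
      IsTwoColoring (matchingsRel t x.1.1 x.2.1)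
        (chosenColoring (matchingsRel t x.1.1 x.2.1)) := fun x =>
    isTwoColoring_chosenColoring (exists_isTwoColoring_matchingsRel htr x.1.2 x.2.2)
  refine (Nat.card_congr (Equiv.ofBijective (fun x =>
    ⟨alternate (chosenColoring (matchingsRel t x.1.1 x.2.1)) x.1.1 x.2.1,
      (isCycleCover_alternate htr x.1.2 x.2.2 (hcol x)).1⟩) ⟨?_, ?_⟩)).symm
  · intro x y hxy
    have h1 := congrArg Subtype.val hxy
    simp only at h1
    -- The chosen colouring depends only on the relation, so equal covers use the same colouring and
    -- their darts can be compared colour by colour.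
    have h2 : matchingsRel t x.1.1 x.2.1 = matchingsRel t y.1.1 y.2.1 := by
      rw [← (isCycleCover_alternate htr x.1.2 x.2.2 (hcol x)).2, h1,
        (isCycleCover_alternate htr y.1.2 y.2.2 (hcol y)).2]
    rw [← h2] at h1
    have h3 := hcol x
    refine Prod.ext (Subtype.ext ?_) (Subtype.ext ?_)
    · refine eq_of_alternate_eq x.1.2 y.1.2 htr (x := true) (fun b => h3 _ _ (Or.inl rfl)) ?_
      intro b hb
      simpa [alternate, hb] using congrFun h1 b
    · refine eq_of_alternate_eq x.2.2 y.2.2 htr (x := false) (fun b => h3 _ _ (Or.inr rfl)) ?_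
      intro b hb
      simpa [alternate, hb] using congrFun h1 b
  · rintro ⟨ε, hε⟩
    have hp := isTwoColoring_chosenColoring (h ε hε)
    set p := chosenColoring (coverRel t ε) with hpdef
    let σ : Equiv.Perm B := Equiv.ofBijective _ hε.2
    have hσ : ∀ b, t (ε b) = σ b := fun b => rfl
    have hpσ : ∀ b, p (σ b) = !p b := fun b => hp _ _ (Or.inl rfl)
    -- Each vertex has an outgoing cover dart and the reversal of its incoming one; `μ` takes the
    -- former on the colour `true`, and `ν` takes it on `false`.
    let μ := alternate p ε fun b => r (ε (σ.symm b))
    let ν := alternate (fun b => !p b) ε fun b => r (ε (σ.symm b))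
    have hμ : IsDartMatching s t r μ := isDartMatching_half hrr hsr htr hε.1 hσ hpσ
    have hν : IsDartMatching s t r ν :=
      isDartMatching_half hrr hsr htr hε.1 hσ (fun b => by rw [hpσ])
    have hR : matchingsRel t μ ν = coverRel t ε := by
      ext b c
      have h5 : b = t (ε c) ↔ c = σ.symm b := by
        rw [hσ, Equiv.eq_symm_apply, eq_comm]
      rw [coverRel, matchingsRel, h5]
      cases hb : p b <;> simp [μ, ν, alternate, hb, htr, hε.1, or_comm]
    refine ⟨(⟨μ, hμ⟩, ⟨ν, hν⟩), Subtype.ext (funext fun b => ?_)⟩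
    simp only [hR]
    rw [← hpdef]
    cases hb : p b <;> simp [μ, ν, alternate, hb]

end Darts

/-! ### Darts of an antipodally symmetric graph -/

namespace EmbeddedGraph

/-- The black vertices. -/
abbrev BlackVertex (Z : EmbeddedGraph Sphere2) (black : Set Sphere2) : Type :=
  {v : Sphere2 // v ∈ Z.vertexSet ∧ v ∈ black}

/-- An antipodally symmetric bipartite graph whose colours are exchanged by the antipodal
involution. Every edge is regarded as a dart from its black end to the antipode of its white end. -/
structure DartSystem (Z : EmbeddedGraph Sphere2) (black : Set Sphere2) where
  inv : Z.AntipodeInvariant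
  color : ∀ v ∈ Z.vertexSet, (-v ∈ black ↔ v ∉ black)
  tail : Z.edgeSet → Z.BlackVertex black
  head : Z.edgeSet → Z.BlackVertex black
  link : ∀ e : Z.edgeSet, Z.IsLink e.1 (tail e : Sphere2) (-(head e : Sphere2))

theorem AntipodeInvariant.nonempty_dartSystem {Z : EmbeddedGraph Sphere2} {black : Set Sphere2}
    (hbipartite : ∀ e x y, Z.IsLink e x y → (x ∈ black ↔ y ∉ black)) (hinv : Z.AntipodeInvariant)
    (hcolor : ∀ v ∈ Z.vertexSet, (-v ∈ black ↔ v ∉ black)) : Nonempty (Z.DartSystem black) := by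
  have h : ∀ e : Z.edgeSet, ∃ b c : Z.BlackVertex black, Z.IsLink e (b : Sphere2) (-(c : Sphere2)) := by
    rintro ⟨e, he⟩
    have key : ∀ x y, Z.IsLink e x y → x ∈ black → ∃ b c : Z.BlackVertex black,
        Z.IsLink e (b : Sphere2) (-(c : Sphere2)) := by
      intro x y hl hx
      have hy := (hbipartite e x y hl).1 hx
      refine ⟨⟨x, hl.left_mem, hx⟩,
        ⟨-y, hinv.1 y hl.right_mem, (hcolor y hl.right_mem).2 hy⟩, ?_⟩
      rwa [neg_neg]
    obtain ⟨x, y, hl⟩ := (Z.edge_mem_iff_exists_isLink e).1 he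
    by_cases hx : x ∈ black
    · exact key x y hl hx
    · exact key y x hl.symm (by_contra fun hy => hx ((hbipartite e x y hl).2 hy))
  choose s t hst using h
  exact ⟨⟨hinv, hcolor, s, t, hst⟩⟩

namespace DartSystem

variable {Z : EmbeddedGraph Sphere2} {black : Set Sphere2} (D : Z.DartSystem black)

include D in
theorem ne_neg (b c : Z.BlackVertex black) : (b : Sphere2) ≠ -c := fun h =>
  (D.color c c.2.1).1 (h ▸ b.2.2) c.2.2

-- The antipode of a black vertex is white, so black vertices represent the vertices of the quotient
-- without repetition.
include D in
theorem toProjPlane_inj {b c : Z.BlackVertex black} :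
    toProjPlane b = toProjPlane c ↔ b = c := by
  rw [toProjPlane_eq_iff, Subtype.ext_iff (a1 := b)]
  have := D.ne_neg b c
  tauto

include D in
theorem exists_black {v : Sphere2} (hv : v ∈ Z.vertexSet) :
    ∃ b : Z.BlackVertex black, v = b ∨ v = -b := by
  by_cases h : v ∈ black
  · exact ⟨⟨v, hv, h⟩, Or.inl rfl⟩
  · exact ⟨⟨-v, D.inv.1 v hv, (D.color v hv).2 h⟩, Or.inr (neg_neg v).symm⟩

/-- The antipodal image of an edge. -/
def rev (e : Z.edgeSet) : Z.edgeSet := ⟨(fun x : Sphere2 => -x) '' e.1, D.inv.2 e.1 e.2⟩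

theorem rev_rev (e : Z.edgeSet) : D.rev (D.rev e) = e := Subtype.ext (image_neg_neg e.1)

theorem eq_of_isLink {e : Z.edgeSet} {b c : Z.BlackVertex black}
    (h : Z.IsLink e (b : Sphere2) (-(c : Sphere2))) : D.tail e = b ∧ D.head e = c := by
  rcases (D.link e).eq_and_eq_or_eq_and_eq h with ⟨h1, h2⟩ | ⟨h1, -⟩
  · exact ⟨Subtype.ext h1, Subtype.ext (neg_inj.1 h2)⟩
  · exact absurd h1 (D.ne_neg _ _)

theorem isLink_rev (e : Z.edgeSet) :
    Z.IsLink (D.rev e) (D.head e : Sphere2) (-(D.tail e : Sphere2)) := by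
  have := (D.inv.isLink_neg (D.link e)).symm
  rwa [neg_neg] at this

theorem tail_rev (e : Z.edgeSet) : D.tail (D.rev e) = D.head e :=
  (D.eq_of_isLink (D.isLink_rev e)).1

theorem head_rev (e : Z.edgeSet) : D.head (D.rev e) = D.tail e :=
  (D.eq_of_isLink (D.isLink_rev e)).2

theorem inc_iff {e : Z.edgeSet} {v : Sphere2} :
    Z.Inc e v ↔ v = D.tail e ∨ v = -D.head e := by
  constructor
  · rintro ⟨y, hy⟩
    rcases (D.link e).eq_and_eq_or_eq_and_eq hy with ⟨h1, -⟩ | ⟨-, h1⟩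
    · exact Or.inl h1.symm
    · exact Or.inr h1.symm
  · rintro (rfl | rfl)
    · exact ⟨_, D.link e⟩
    · exact ⟨_, (D.link e).symm⟩

theorem inc_black_iff {e : Z.edgeSet} {b : Z.BlackVertex black} :
    Z.Inc e (b : Sphere2) ↔ D.tail e = b := by
  rw [D.inc_iff, Subtype.ext_iff (a1 := D.tail e), or_iff_left (D.ne_neg _ _), eq_comm]

theorem inc_neg_iff {e : Z.edgeSet} {b : Z.BlackVertex black} :
    Z.Inc e (-b : Sphere2) ↔ D.head e = b := by
  rw [D.inc_iff, Subtype.ext_iff (a1 := D.head e), neg_inj, or_iff_right (D.ne_neg _ _).symm, eq_comm]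

theorem isPerfectMatching_range {ε : Z.BlackVertex black → Z.edgeSet}
    (h : IsCycleCover D.tail D.head ε) :
    Z.toGraph.IsPerfectMatching (Set.range fun b => (ε b : Set Sphere2)) := by
  refine ⟨?_, ?_, ?_⟩
  · rintro _ ⟨b, rfl⟩
    exact (ε b).2
  · rintro _ ⟨b, rfl⟩ v hv
    rcases (D.link (ε b)).eq_and_eq_or_eq_and_eq hv with ⟨h1, h2⟩ | ⟨h1, h2⟩ <;>
    · rw [← h2] at h1
      exact D.ne_neg _ _ h1
  · intro v hv
    obtain ⟨b, rfl | rfl⟩ := D.exists_black hv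
    · refine ⟨ε b, ⟨⟨b, rfl⟩, D.inc_black_iff.2 (h.1 b)⟩, ?_⟩
      rintro _ ⟨⟨c, rfl⟩, hc⟩
      rw [D.inc_black_iff, h.1] at hc
      rw [hc]
    · obtain ⟨c, hc⟩ := h.2.2 b
      refine ⟨ε c, ⟨⟨c, rfl⟩, D.inc_neg_iff.2 hc⟩, ?_⟩
      rintro _ ⟨⟨d, rfl⟩, hd⟩
      rw [D.inc_neg_iff, ← hc] at hd
      rw [h.2.1 hd]

/-- `ε` assigns to each black vertex its matching edge. Since the white vertices are the antipodes
of the black ones, covering each white vertex once means that heads are bijective. -/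
theorem numPerfectMatchings_eq :
    Z.toGraph.numPerfectMatchings = Nat.card {ε // IsCycleCover D.tail D.head ε} := by
  rw [Graph.numPerfectMatchings, ← Nat.card_coe_set_eq]
  refine (Nat.card_congr (Equiv.ofBijective (fun ε => ⟨_, D.isPerfectMatching_range ε.2⟩)
    ⟨?_, ?_⟩)).symm
  · rintro ⟨ε, hε⟩ ⟨ε', hε'⟩ h
    refine Subtype.ext (funext fun b => ?_)
    have h1 : (ε b : Set Sphere2) ∈ Set.range fun b => (ε' b : Set Sphere2) := by
      have h2 := congrArg Subtype.val h
      simp only at h2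
      exact h2 ▸ ⟨b, rfl⟩
    obtain ⟨c, hc⟩ := h1
    have h2 : ε' c = ε b := Subtype.ext hc
    have h3 : c = b := by rw [← hε'.1 c, h2, hε.1]
    exact (h3 ▸ h2).symm
  · rintro ⟨m, hm1, -, hm3⟩
    have hex : ∀ b : Z.BlackVertex black, ∃ e : Z.edgeSet, (e : Set Sphere2) ∈ m ∧ D.tail e = b := by
      intro b
      obtain ⟨e, ⟨he, hi⟩, -⟩ := hm3 b b.2.1
      exact ⟨⟨e, hm1 he⟩, he, D.inc_black_iff.1 hi⟩
    choose ε hεm hε using hex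
    have huniq : ∀ e : Z.edgeSet, (e : Set Sphere2) ∈ m → ε (D.tail e) = e := fun e he =>
      Subtype.ext ((hm3 _ (D.tail e).2.1).unique ⟨hεm _, D.inc_black_iff.2 (hε _)⟩
        ⟨he, D.inc_black_iff.2 rfl⟩)
    refine ⟨⟨ε, hε, fun b c hbc => ?_, fun d => ?_⟩, Subtype.ext ?_⟩
    · have h1 := (hm3 _ (D.inv.1 _ (D.head (ε c)).2.1)).unique
        ⟨hεm b, D.inc_neg_iff.2 hbc⟩ ⟨hεm c, D.inc_neg_iff.2 rfl⟩
      rw [← hε b, Subtype.ext h1, hε c]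
    · obtain ⟨e, ⟨he, hi⟩, -⟩ := hm3 _ (D.inv.1 _ d.2.1)
      refine ⟨D.tail ⟨e, hm1 he⟩, ?_⟩
      simp only
      rw [huniq ⟨e, hm1 he⟩ he]
      exact D.inc_neg_iff.1 hi
    · ext e
      constructor
      · rintro ⟨b, rfl⟩
        exact hεm b
      · intro he
        exact ⟨D.tail ⟨e, hm1 he⟩, congrArg Subtype.val (huniq ⟨e, hm1 he⟩ he)⟩

theorem image_rev (e : Z.edgeSet) :
    toProjPlane '' (D.rev e : Set Sphere2) = toProjPlane '' (e : Set Sphere2) := by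
  simp only [rev, Set.image_image, toProjPlane_neg]

theorem eq_or_eq_rev {e f : Z.edgeSet}
    (h : toProjPlane '' (e : Set Sphere2) = toProjPlane '' (f : Set Sphere2)) :
    e = f ∨ e = D.rev f := by
  rcases D.inv.eq_or_eq e.2 f.2 h with h | h
  · exact Or.inl (Subtype.ext h)
  · exact Or.inr (Subtype.ext h)

theorem quotient_isLink_iff {e : Z.edgeSet} {x y : ProjPlane} :
    (Z.antipodeQuotient D.inv).IsLink (toProjPlane '' (e : Set Sphere2)) x y ↔
      (x = toProjPlane (D.tail e) ∧ y = toProjPlane (D.head e)) ∨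
        (x = toProjPlane (D.head e) ∧ y = toProjPlane (D.tail e)) := by
  have hlink : (Z.antipodeQuotient D.inv).IsLink (toProjPlane '' (e : Set Sphere2))
      (toProjPlane (D.tail e)) (toProjPlane (D.head e)) :=
    ⟨e, _, _, D.link e, rfl, rfl, toProjPlane_neg _⟩
  constructor
  · intro h
    rcases hlink.eq_and_eq_or_eq_and_eq h with ⟨h1, h2⟩ | ⟨h1, h2⟩
    · exact Or.inl ⟨h1.symm, h2.symm⟩
    · exact Or.inr ⟨h2.symm, h1.symm⟩
  · rintro (⟨rfl, rfl⟩ | ⟨rfl, rfl⟩)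
    · exact hlink
    · exact hlink.symm

theorem quotient_inc_iff {e : Z.edgeSet} {b : Z.BlackVertex black} :
    (Z.antipodeQuotient D.inv).Inc (toProjPlane '' (e : Set Sphere2)) (toProjPlane b) ↔
      D.tail e = b ∨ D.head e = b := by
  simp only [Graph.Inc, D.quotient_isLink_iff, D.toProjPlane_inj, exists_or, exists_and_left,
    exists_eq, and_true, eq_comm]

theorem tail_eq_head_of_isLoopAt {e : Z.edgeSet} {v : ProjPlane}
    (h : (Z.antipodeQuotient D.inv).IsLoopAt (toProjPlane '' (e : Set Sphere2)) v) :
    D.tail e = D.head e := by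
  rcases D.quotient_isLink_iff.1 h with ⟨h1, h2⟩ | ⟨h1, h2⟩
  · exact D.toProjPlane_inj.1 (h1.symm.trans h2)
  · exact D.toProjPlane_inj.1 (h2.symm.trans h1)

theorem isPerfectMatching_quotient_range {μ : Z.BlackVertex black → Z.edgeSet}
    (h : IsDartMatching D.tail D.head D.rev μ) :
    (Z.antipodeQuotient D.inv).toGraph.IsPerfectMatching
      (Set.range fun b => toProjPlane '' (μ b : Set Sphere2)) := by
  refine ⟨?_, ?_, ?_⟩
  · rintro _ ⟨b, rfl⟩
    exact ⟨_, (μ b).2, rfl⟩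
  · rintro _ ⟨b, rfl⟩ v hv
    have := D.tail_eq_head_of_isLoopAt hv
    rw [h.1] at this
    exact (h.2 b).1 this.symm
  · rintro _ ⟨v, hv, rfl⟩
    obtain ⟨b, hb⟩ : ∃ b : Z.BlackVertex black, toProjPlane v = toProjPlane b := by
      obtain ⟨b, hb⟩ := D.exists_black hv
      exact ⟨b, toProjPlane_eq_iff.2 hb⟩
    rw [hb]
    refine ⟨_, ⟨⟨b, rfl⟩, D.quotient_inc_iff.2 (Or.inl (h.1 b))⟩, ?_⟩
    rintro _ ⟨⟨c, rfl⟩, hc⟩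
    simp only at hc ⊢
    rcases D.quotient_inc_iff.1 hc with h1 | h1
    · rw [h.1] at h1
      rw [h1]
    · have := (h.2 c).2
      rw [h1] at this
      rw [this, D.image_rev]

/-- A matching edge of the quotient has two lifts, reversals of each other; each of its ends
receives the lift that leaves it. The ban on loops makes this lift unique. -/
theorem numPerfectMatchings_quotient_eq :
    (Z.antipodeQuotient D.inv).toGraph.numPerfectMatchings =
      Nat.card {μ // IsDartMatching D.tail D.head D.rev μ} := by
  rw [Graph.numPerfectMatchings, ← Nat.card_coe_set_eq]
  refine (Nat.card_congr (Equiv.ofBijective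
    (fun μ => ⟨_, D.isPerfectMatching_quotient_range μ.2⟩) ⟨?_, ?_⟩)).symm
  · rintro ⟨μ, hμ⟩ ⟨μ', hμ'⟩ h
    refine Subtype.ext (funext fun b => ?_)
    have h1 : toProjPlane '' (μ b : Set Sphere2) ∈
        Set.range fun b => toProjPlane '' (μ' b : Set Sphere2) := by
      have h2 := congrArg Subtype.val h
      simp only at h2
      exact h2 ▸ ⟨b, rfl⟩
    obtain ⟨c, hc⟩ := h1
    have h4 : ∃ d, μ' d = μ b := by
      rcases D.eq_or_eq_rev hc with h2 | h2
      · exact ⟨c, h2⟩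
      · exact ⟨D.head (μ' c), by rw [(hμ'.2 c).2, h2, D.rev_rev]⟩
    obtain ⟨d, hd⟩ := h4
    have h3 : d = b := by rw [← hμ'.1 d, hd, hμ.1]
    exact (h3 ▸ hd).symm
  · rintro ⟨m, hm1, hm2, hm3⟩
    have hex : ∀ b : Z.BlackVertex black, ∃ e : Z.edgeSet,
        toProjPlane '' (e : Set Sphere2) ∈ m ∧ D.tail e = b := by
      intro b
      obtain ⟨e', ⟨he, hi⟩, -⟩ := hm3 (toProjPlane b) ⟨b, b.2.1, rfl⟩
      obtain ⟨e, hee, rfl⟩ := hm1 he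
      rcases D.quotient_inc_iff (e := ⟨e, hee⟩).1 hi with h | h
      · exact ⟨⟨e, hee⟩, he, h⟩
      · exact ⟨D.rev ⟨e, hee⟩, by rwa [D.image_rev], by rw [D.tail_rev, h]⟩
    choose μ hμm hμ using hex
    have hloop : ∀ e : Z.edgeSet, toProjPlane '' (e : Set Sphere2) ∈ m → D.tail e ≠ D.head e := by
      intro e he h
      refine hm2 _ he (toProjPlane (D.tail e)) (D.quotient_isLink_iff.2 (Or.inl ⟨rfl, ?_⟩))
      rw [h]
    have huniq : ∀ e : Z.edgeSet, toProjPlane '' (e : Set Sphere2) ∈ m → μ (D.tail e) = e := by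
      intro e he
      have h1 := (hm3 (toProjPlane (D.tail e)) ⟨_, (D.tail e).2.1, rfl⟩).unique
        ⟨hμm _, D.quotient_inc_iff.2 (Or.inl (hμ _))⟩ ⟨he, D.quotient_inc_iff.2 (Or.inl rfl)⟩
      rcases D.eq_or_eq_rev h1 with h2 | h2
      · exact h2
      · refine absurd ?_ (hloop e he)
        rw [← D.tail_rev e, ← h2, hμ]
    refine ⟨⟨μ, hμ, fun b => ⟨fun h => hloop _ (hμm b) (by rw [h, hμ]), ?_⟩⟩, Subtype.ext ?_⟩
    · rw [← D.tail_rev]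
      exact huniq _ (by rw [D.image_rev]; exact hμm b)
    · ext e'
      constructor
      · rintro ⟨b, rfl⟩
        exact hμm b
      · intro he
        obtain ⟨e, hee, rfl⟩ := hm1 he
        refine ⟨D.tail ⟨e, hee⟩, ?_⟩
        simp only
        rw [huniq ⟨e, hee⟩ he]

include D in
theorem card_vertexSet : Z.vertexSet.ncard = 2 * Nat.card (Z.BlackVertex black) := by
  have h : Z.vertexSet.ncard = Nat.card (Z.BlackVertex black ⊕ Z.BlackVertex black) := by
    rw [← Nat.card_coe_set_eq]
    refine (Nat.card_congr (Equiv.ofBijective (Sum.elim (fun b => ⟨b, b.2.1⟩)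
      fun b => ⟨-b, D.inv.1 _ b.2.1⟩) ⟨?_, ?_⟩)).symm
    · rintro (b | b) (c | c) h <;> have h1 := congrArg Subtype.val h <;>
        simp only [Sum.elim_inl, Sum.elim_inr] at h1
      · rw [Subtype.ext h1]
      · exact absurd h1 (D.ne_neg _ _)
      · exact absurd h1.symm (D.ne_neg _ _)
      · rw [Subtype.ext (neg_inj.1 h1)]
    · rintro ⟨v, hv⟩
      obtain ⟨b, rfl | rfl⟩ := D.exists_black hv
      · exact ⟨Sum.inl b, rfl⟩
      · exact ⟨Sum.inr b, rfl⟩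
  have hfin : Finite (Z.BlackVertex black) :=
    (Z.finite_vertexSet.subset fun v hv => hv.1 : {v | v ∈ Z.vertexSet ∧ v ∈ black}.Finite)
  rw [h, Nat.card_sum, two_mul]

/-! ### Absence of odd orbits -/

/-- The points of the edges of a cycle cover that leave a given orbit, and their antipodes. -/
def orbitSupport (ε : Z.BlackVertex black → Z.edgeSet) (σ : Equiv.Perm (Z.BlackVertex black))
    (b : Z.BlackVertex black) : Set Sphere2 :=
  {x | ∃ c, σ.SameCycle b c ∧ (x ∈ (ε c : Set Sphere2) ∨ -x ∈ (ε c : Set Sphere2))}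

theorem neg_mem_orbitSupport {ε : Z.BlackVertex black → Z.edgeSet}
    {σ : Equiv.Perm (Z.BlackVertex black)} {b : Z.BlackVertex black} {x : Sphere2}
    (hx : x ∈ orbitSupport ε σ b) : -x ∈ orbitSupport ε σ b := by
  obtain ⟨c, hc, h⟩ := hx
  exact ⟨c, hc, by rw [neg_neg]; exact h.symm⟩

/-- An orbit of odd period of a cycle cover contains a path from a point to its antipode. -/
theorem joinedIn_orbitSupport {ε : Z.BlackVertex black → Z.edgeSet}
    {σ : Equiv.Perm (Z.BlackVertex black)} (hs : ∀ b, D.tail (ε b) = b)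
    (hσ : ∀ b, D.head (ε b) = σ b) {b : Z.BlackVertex black} {k : ℕ} (hk : Odd k)
    (hb : (σ ^ k) b = b) : JoinedIn (orbitSupport ε σ b) (b : Sphere2) (-b) := by
  have step : ∀ c, σ.SameCycle b c →
      JoinedIn (orbitSupport ε σ b) (c : Sphere2) (-(σ c : Z.BlackVertex black)) := by
    intro c hc
    have hl := D.link (ε c)
    rw [hs, hσ] at hl
    obtain ⟨γ, -, hr, -⟩ := Z.exists_path hl
    exact ⟨γ, fun t => ⟨c, hc, Or.inl (hr ▸ ⟨t, rfl⟩)⟩⟩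
  have neg : ∀ {x y : Sphere2}, JoinedIn (orbitSupport ε σ b) x y →
      JoinedIn (orbitSupport ε σ b) (-x) (-y) := by
    rintro x y ⟨γ, hγ⟩
    exact ⟨γ.map continuous_neg, fun t => neg_mem_orbitSupport (hγ t)⟩
  have same : ∀ j : ℕ, σ.SameCycle b ((σ ^ j) b) := fun j => ⟨j, by rw [zpow_natCast]⟩
  have succ : ∀ j : ℕ, (σ ^ (j + 1)) b = σ ((σ ^ j) b) := fun j => by
    rw [pow_succ', Equiv.Perm.mul_apply]
  -- Each dart flips the sheet: an edge leads from `c` to `-σ c`, and the antipode of the next edge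
  -- from `-σ c` to `σ (σ c)`. An odd number of steps back to `b` therefore ends at `-b`.
  have even : ∀ j : ℕ, JoinedIn (orbitSupport ε σ b) (b : Sphere2) ((σ ^ (2 * j)) b) := by
    intro j
    induction j with
    | zero => exact JoinedIn.refl (step b (.refl _ _)).source_mem
    | succ j ih =>
      have h1 := step _ (same (2 * j))
      have h2 := neg (step _ (same (2 * j + 1)))
      rw [neg_neg, ← succ] at h2
      rw [← succ] at h1
      exact (ih.trans h1).trans h2
  obtain ⟨j, rfl⟩ := hk
  have h1 := (even j).trans (step _ (same (2 * j)))
  rwa [← succ, hb] at h1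

/-- A common point that is not a vertex would lie on a single edge, whose tail belongs to both
orbits; a common vertex would represent one black vertex in both orbits. Reversal keeps the ends of
a dart in the same orbit. -/
theorem disjoint_orbitSupport {ε : Z.BlackVertex black → Z.edgeSet}
    {σ : Equiv.Perm (Z.BlackVertex black)} (hs : ∀ b, D.tail (ε b) = b)
    (hσ : ∀ b, D.head (ε b) = σ b) {b c : Z.BlackVertex black} (hbc : ¬ σ.SameCycle b c) :
    Disjoint (orbitSupport ε σ b) (orbitSupport ε σ c) := by
  rw [Set.disjoint_left]
  rintro x ⟨b', hb', hx⟩ ⟨c', hc', hx'⟩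
  -- an edge of either orbit that contains `x`
  have dart : ∀ {d d' : Z.BlackVertex black}, σ.SameCycle d d' →
      (x ∈ (ε d' : Set Sphere2) ∨ -x ∈ (ε d' : Set Sphere2)) → ∃ e : Z.edgeSet,
        x ∈ (e : Set Sphere2) ∧ σ.SameCycle d (D.tail e) ∧ σ.SameCycle d (D.head e) := by
    intro d d' hd h
    rcases h with h | h
    · exact ⟨ε d', h, by rwa [hs], by rwa [hσ, Equiv.Perm.sameCycle_apply_right]⟩
    · exact ⟨D.rev (ε d'), ⟨-x, h, neg_neg x⟩,
        by rwa [D.tail_rev, hσ, Equiv.Perm.sameCycle_apply_right], by rwa [D.head_rev, hs]⟩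
  obtain ⟨e, hxe, e1, e2⟩ := dart hb' hx
  obtain ⟨f, hxf, f1, f2⟩ := dart hc' hx'
  by_cases hxV : x ∈ Z.vertexSet
  · have ends : ∀ {d : Z.BlackVertex black} {e : Z.edgeSet}, x ∈ (e : Set Sphere2) →
        σ.SameCycle d (D.tail e) → σ.SameCycle d (D.head e) →
        ∃ v : Z.BlackVertex black, σ.SameCycle d v ∧ toProjPlane x = toProjPlane v := by
      intro d e hxe h1 h2
      obtain ⟨-, -, -, hV⟩ := Z.exists_path (D.link e)
      have h3 : x ∈ ({(D.tail e : Sphere2), -(D.head e : Sphere2)} : Set Sphere2) :=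
        hV ▸ ⟨hxe, hxV⟩
      rcases h3 with h3 | h3
      · exact ⟨_, h1, by rw [h3]⟩
      · exact ⟨_, h2, by rw [h3, toProjPlane_neg]⟩
    obtain ⟨v, hv, hxv⟩ := ends hxe e1 e2
    obtain ⟨w, hw, hxw⟩ := ends hxf f1 f2
    have := D.toProjPlane_inj.1 (hxv.symm.trans hxw)
    exact hbc (hv.trans (this ▸ hw.symm))
  · have := Subtype.ext (Z.eq_of_mem_inter e.2 f.2 hxe hxf hxV)
    exact hbc (e1.trans (this ▸ f1.symm))

/-- Two orbits of odd period of a cycle cover coincide. -/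
theorem sameCycle_of_odd {ε : Z.BlackVertex black → Z.edgeSet}
    {σ : Equiv.Perm (Z.BlackVertex black)} (hs : ∀ b, D.tail (ε b) = b)
    (hσ : ∀ b, D.head (ε b) = σ b) {b c : Z.BlackVertex black} {k l : ℕ} (hk : Odd k)
    (hl : Odd l) (hb : (σ ^ k) b = b) (hc : (σ ^ l) c = c) : σ.SameCycle b c := by
  by_contra hbc
  obtain ⟨α, hα⟩ := D.joinedIn_orbitSupport hs hσ hk hb
  obtain ⟨β, hβ⟩ := D.joinedIn_orbitSupport hs hσ hl hc
  -- The supports are closed under antipodes, so meeting up to sign already contradicts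
  -- disjointness.
  have hdisj := Set.disjoint_left.1 (D.disjoint_orbitSupport hs hσ hbc)
  obtain ⟨s, t, h | h⟩ := Sphere2.exists_eq_or_eq_neg α β
  · exact hdisj (hα s) (h ▸ hβ t)
  · exact hdisj (hα s) (h ▸ neg_mem_orbitSupport (hβ t))

/-- Parity forces any odd orbit to have a companion, and topology forbids two of them. This also
excludes fixed points, that is, loops of the quotient. -/
theorem exists_isTwoColoring (hB : Even (Nat.card (Z.BlackVertex black)))
    (ε : Z.BlackVertex black → Z.edgeSet) (hε : IsCycleCover D.tail D.head ε) :
    ∃ p, IsTwoColoring (coverRel D.head ε) p := by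
  have hfin : Finite (Z.BlackVertex black) :=
    (Z.finite_vertexSet.subset fun v hv => hv.1 : {v | v ∈ Z.vertexSet ∧ v ∈ black}.Finite)
  let σ : Equiv.Perm (Z.BlackVertex black) := Equiv.ofBijective _ hε.2
  have hσ : ∀ b, D.head (ε b) = σ b := fun b => rfl
  obtain ⟨p, hp⟩ := σ.exists_coloring (fun b k hk hb => by
    obtain ⟨c, hbc, j, hj, hc⟩ := σ.exists_second_odd_orbit hB hk hb
    refine hbc (D.sameCycle_of_odd hε.1 hσ (Int.natAbs_odd.2 hk) hj ?_ hc)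
    rcases Int.natAbs_eq k with h | h
    · rwa [h, zpow_natCast] at hb
    · rw [h, zpow_neg, Equiv.Perm.inv_eq_iff_eq, zpow_natCast] at hb
      exact hb.symm)
  refine ⟨p, ?_⟩
  rintro b c (rfl | rfl)
  · rw [hσ, hp]
  · rw [hσ, hp, Bool.not_not]

end DartSystem

end EmbeddedGraph

theorem mainTheorem1 (n : ℕ) (Z : EmbeddedGraph Sphere2)
    (hcard : Z.vertexSet.ncard = 4 * n)
    (black : Set Sphere2)
    (hbipartite : ∀ e x y, Z.IsLink e x y → (x ∈ black ↔ y ∉ black))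
    (hinv : Z.AntipodeInvariant)
    (hcolor : ∀ v ∈ Z.vertexSet, (-v ∈ black ↔ v ∉ black)) :
    Z.toGraph.numPerfectMatchings =
      (Z.antipodeQuotient hinv).toGraph.numPerfectMatchings ^ 2 := by
  obtain ⟨D⟩ := hinv.nonempty_dartSystem hbipartite hcolor
  have hB : Even (Nat.card (Z.BlackVertex black)) := by
    have := D.card_vertexSet
    -- Half of the `4 * n` vertices are black, which gives `n + n`.
    exact ⟨n, by omega⟩
  rw [D.numPerfectMatchings_eq, D.numPerfectMatchings_quotient_eq]
  exact card_cycleCover_eq D.rev_rev D.tail_rev D.head_rev (D.exists_isTwoColoring hB)
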